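/- **Setting.** Let $(\Omega,\mathcal A,\mathbb P)$ be a probability space with a filtration $(\mathcal F_t)_{t\ge 0}$, write $\mathbb E_{t-1}=\mathbb E[\,\cdot\mid\mathcal F_{t-1}]$ and let $\mathcal B_1=\{\theta\in\mathbb R^d:\|\theta\|_1\le 1\}$. Let $(\ell_t)_{t\ge1}$ be random losses $\mathbb R^d\to\mathbb R$ such that, for every $t\ge 1$, $\ell_t$ is almost surely convex, $\nabla\ell_t(\theta)$ is a subgradient of $\ell_t$ at $\theta$ for $\theta\in\mathcal B_1$, $\ell_t(\theta)$ is integrable for $\theta\in\mathcal B_1$, and $\ell_t$ and $(\omega,\theta)\mapsto\nabla\ell_t(\theta)$ are $\mathcal F_t$-measurable. Assume: * (A1) $\sup_{\theta\in\mathcal B_1}\|\nabla\ell_t(\theta)\|_\infty\le G$ almost surely, for all $t\ge1$; * (A2) $\alpha>0$ and $\beta\in[0,1]$ are such that for all $t\ge 1$ and all $\theta_1,\theta_2\in\mathcal B_1$, almost surely $$\mathbb E_{t-1}[\ell_t(\theta_1)-\ell_t(\theta_2)]\le \mathbb E_{t-1}[\nabla\ell_t(\theta_1)^\top(\theta_1-\theta_2)]-\mathbb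 E_{t-1}\Big[\big(\alpha(\nabla\ell_t(\theta_1)^\top(\theta_1-\theta_2))^2\big)^{1/\beta}\Big],$$ where for $\beta=0$ the power $y^{1/\beta}$ is read as $0$ if $y\le1$ and $+\infty$ if $y>1$. **Algorithm.** Let $T\ge1$ be an integer with $GT\ge e$, let $E=4G/3$, and let $\Theta_0=\{\theta_1,\dots,\theta_K\}\subset\mathcal B_1$ be a $T^{-2}$-cover of $\mathcal B_1$ in $\ell_1$-norm, of minimal cardinality among the covers by points of $\mathcal B_1$. Use the learning rates $\eta_i=(e^iE)^{-1}$, $1\le i\le N$, where either $N=\lfloor\log(ET)\rfloor$ and $G^2T\ge1$, or $N=\lfloor\log(ET^2)\rfloor$. In round $t=1,\dots,T$ predict $\hat\theta_{t-1}=\sum_k\hat\pi_{k,t-1}\theta_k$, where $\hat\pi_{k,0}=1/K$ and $$\hat\pi_{k,t}=\frac{\sum_{i=1}^N\eta_i e^{\eta_i\sum_{s=1}^t(r_{k,s}-\eta_i r_{k,s}^2)}\hat\pi_{k,0}}{\sum_{j=1}^K\sum_{i=1}^N\eta_i e^{\eta_i\sum_{s=1}^t(r_{j,s}-\eta_i r_{j,s}^2)}\hat\pi_{j,0}},\qquad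 r_{k,s}=\nabla\ell_s(\hat\theta_{s-1})^\top(\hat\theta_{s-1}-\theta_k).$$ **Claim.** Let $R_T(\theta)=\frac1T\sum_{t=1}^T\mathbb E_{t-1}[\ell_t(\hat\theta_{t-1})]-\frac1T\sum_{t=1}^T\mathbb E_{t-1}[\ell_t(\theta)]$, let $x>0$ and put $a=d\log T+\log\log(GT)+x$. There is a universal constant $C$ (independent of all the objects above) such that, on an event of probability at least $1-2e^{-x}$, for every $\theta\in\mathcal B_1$, almost surely, $$R_T(\theta)\le C\left(\Big(\frac{a}{\alpha T}\Big)^{\frac1{2-\beta}}+\frac{G}{T^2}+\frac{G\,a}{T}\right),$$ and, if $\alpha G^{2-\beta}\le1$, also $$R_T(\theta)\le C\left(\Big(\frac{a}{\alpha T}\Big)^{\frac1{2-\beta}}+\frac{G}{T^2}\right).$$ -/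

import Mathlib

open MeasureTheory

noncomputable section

/-- The parameter space `ℝ^d`, equipped with the `ℓ₁`-norm. -/
abbrev Param (d : ℕ) : Type := PiLp 1 (fun _ : Fin d => ℝ)

/-- The closed unit ball of the `ℓ₁`-norm. -/
def unitBall (d : ℕ) : Set (Param d) := Metric.closedBall 0 1

/-- The scalar product `gᵀ v`. Gradients live in `Fin d → ℝ`, whose norm is the `ℓ_∞`-norm. -/
def pairing {d : ℕ} (g : Fin d → ℝ) (v : Param d) : ℝ := ∑ i, g i * v i

/-- `g` is a subgradient at `u` of the function `f`. -/
def IsSubgradientAt {d : ℕ} (f : Param d → ℝ) (u : Param d) (g : Fin d → ℝ) : Prop :=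
  ∀ v : Param d, f u + pairing g (v - u) ≤ f v

/-- `Θ₀` is an `ε`-cover of the unit ball, in `ℓ₁`-norm and by points of the ball, of minimal
cardinality. -/
def IsMinimalCover {d : ℕ} (ε : NNReal) (Θ₀ : Finset (Param d)) : Prop :=
  (Θ₀ : Set (Param d)) ⊆ unitBall d ∧
  Metric.IsCover ε (unitBall d) (Θ₀ : Set (Param d)) ∧
  (Θ₀.card : ℕ∞) = Metric.coveringNumber ε (unitBall d)

/-! ### The algorithm (Squint / BOA with `N` constant learning rates) -/

/-- The learning rate `η_i = (e^i E)⁻¹`. -/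
def learningRate (E : ℝ) (i : ℕ) : ℝ := (Real.exp i * E)⁻¹

/-- The unnormalised weight `∑_{i=1}^N η_i exp (η_i (L - η_i Q)) p` of an expert with prior
weight `p`, cumulative linearised regret `L` and cumulative squared linearised regret `Q`. -/
def rawWeight (E : ℝ) (N : ℕ) (p L Q : ℝ) : ℝ :=
  ∑ i ∈ Finset.Icc 1 N,
    learningRate E i * Real.exp (learningRate E i * (L - learningRate E i * Q)) * p

/-- The prediction: the average of the points of the grid for the normalised weights, when `S θ`
is the pair of the cumulative linearised regret and the cumulative squared linearised regret
of `θ`. -/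
def aggregate {d : ℕ} (Θ₀ : Finset (Param d)) (prior : Param d → ℝ) (E : ℝ) (N : ℕ)
    (S : Param d → ℝ × ℝ) : Param d :=
  ∑ θ ∈ Θ₀, (rawWeight E N (prior θ) (S θ).1 (S θ).2 /
    ∑ ϑ ∈ Θ₀, rawWeight E N (prior ϑ) (S ϑ).1 (S ϑ).2) • θ

/-- For each `θ`, the pair `(∑_{s ≤ t} r_s, ∑_{s ≤ t} r_s ^ 2)`, where
`r_s = ∇ℓ_s(θ̂_{s-1})ᵀ (θ̂_{s-1} - θ)` and `grad s` is the gradient oracle `∇ℓ_s`. -/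
def squintState {d : ℕ} (Θ₀ : Finset (Param d)) (prior : Param d → ℝ) (E : ℝ) (N : ℕ)
    (grad : ℕ → Param d → Fin d → ℝ) : ℕ → Param d → ℝ × ℝ
  | 0 => fun _ => (0, 0)
  | t + 1 => fun θ =>
      let S := squintState Θ₀ prior E N grad t
      let p := aggregate Θ₀ prior E N S
      let r := pairing (grad (t + 1) p) (p - θ)
      ((S θ).1 + r, (S θ).2 + r ^ 2)

/-- The prediction `θ̂_t`, computed from the gradients of rounds `1, …, t` and used in
round `t + 1`. -/
def squint {d : ℕ} (Θ₀ : Finset (Param d)) (prior : Param d → ℝ) (E : ℝ) (N : ℕ)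
    (grad : ℕ → Param d → Fin d → ℝ) (t : ℕ) : Param d :=
  aggregate Θ₀ prior E N (squintState Θ₀ prior E N grad t)

/-- The uniform prior on a finite grid. -/
def uniformPrior {d : ℕ} (Θ₀ : Finset (Param d)) : Param d → ℝ := fun _ => 1 / (Θ₀.card : ℝ)

/-! ### The losses, in rounds `t = 1, 2, …` -/

variable {Ω : Type*} {m0 : MeasurableSpace Ω}

/-- `ℓ t ω` is the loss function of round `t ≥ 1`, and `grad t ω θ` a subgradient of it at `θ`.
Here `ℱ t` is the information available at the end of round `t`. -/
structure IsConvexLossSequence (P : Measure Ω) (ℱ : Filtration ℕ m0) {d : ℕ}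
    (ℓ : ℕ → Ω → Param d → ℝ) (grad : ℕ → Ω → Param d → Fin d → ℝ) : Prop where
  loss_adapted : ∀ t, 1 ≤ t → ∀ θ, Measurable[ℱ t] (fun ω => ℓ t ω θ)
  loss_integrable : ∀ t, 1 ≤ t → ∀ θ ∈ unitBall d, Integrable (fun ω => ℓ t ω θ) P
  loss_convex : ∀ t, 1 ≤ t → ∀ᵐ ω ∂P, ConvexOn ℝ Set.univ (ℓ t ω)
  grad_adapted : ∀ t, 1 ≤ t →
    @Measurable (Ω × Param d) (Fin d → ℝ) ((ℱ t).prod inferInstance) inferInstance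
      (fun p => grad t p.1 p.2)
  grad_subgradient : ∀ t, 1 ≤ t → ∀ᵐ ω ∂P, ∀ θ ∈ unitBall d,
    IsSubgradientAt (ℓ t ω) θ (grad t ω θ)

/-- Lipschitz losses: the `ℓ_∞`-norm of the gradients on the unit ball is at most `G`. -/
def LipschitzLoss (P : Measure Ω) {d : ℕ} (grad : ℕ → Ω → Param d → Fin d → ℝ) (G : ℝ) : Prop :=
  ∀ t, 1 ≤ t → ∀ᵐ ω ∂P, ∀ θ ∈ unitBall d, ‖grad t ω θ‖ ≤ G

/-- Weak exp-concavity with parameters `α` and `β`. For `β = 0`, the power `y ^ (1 / β)` is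
read as `0` if `y ≤ 1` and as `+∞` if `y > 1`, so that the inequality forces `y ≤ 1` almost
surely. -/
def WeakExpConcave (P : Measure Ω) (ℱ : Filtration ℕ m0) {d : ℕ}
    (ℓ : ℕ → Ω → Param d → ℝ) (grad : ℕ → Ω → Param d → Fin d → ℝ) (α β : ℝ) : Prop :=
  ∀ t, 1 ≤ t → ∀ θ₁ ∈ unitBall d, ∀ θ₂ ∈ unitBall d,
    (0 < β → ∀ᵐ ω ∂P,
      (P[fun ω' => ℓ t ω' θ₁ - ℓ t ω' θ₂ | ℱ (t - 1)]) ω ≤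
        (P[fun ω' => pairing (grad t ω' θ₁) (θ₁ - θ₂) | ℱ (t - 1)]) ω -
        (P[fun ω' => (α * pairing (grad t ω' θ₁) (θ₁ - θ₂) ^ 2) ^ (1 / β) | ℱ (t - 1)]) ω) ∧
    (β = 0 →
      (∀ᵐ ω ∂P, α * pairing (grad t ω θ₁) (θ₁ - θ₂) ^ 2 ≤ 1) ∧
      ∀ᵐ ω ∂P,
        (P[fun ω' => ℓ t ω' θ₁ - ℓ t ω' θ₂ | ℱ (t - 1)]) ω ≤
          (P[fun ω' => pairing (grad t ω' θ₁) (θ₁ - θ₂) | ℱ (t - 1)]) ω)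

/-- The average risk `R_T(θ)` of the predictions `pred 0, …, pred (T - 1)` (`pred (t - 1)` is
used in round `t`), relative to `θ`. -/
def averageRisk (P : Measure Ω) (ℱ : Filtration ℕ m0) {d : ℕ}
    (ℓ : ℕ → Ω → Param d → ℝ) (pred : ℕ → Ω → Param d) (T : ℕ) (θ : Param d) (ω : Ω) : ℝ :=
  1 / (T : ℝ) * ∑ t ∈ Finset.Icc 1 T, (P[fun ω' => ℓ t ω' (pred (t - 1) ω') | ℱ (t - 1)]) ω -
  1 / (T : ℝ) * ∑ t ∈ Finset.Icc 1 T, (P[fun ω' => ℓ t ω' θ | ℱ (t - 1)]) ω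

/-- The complexity term `d log T + log log (G T) + x`. -/
def complexityTerm (d T : ℕ) (G x : ℝ) : ℝ :=
  d * Real.log T + Real.log (Real.log (G * T)) + x

end

/-!
The predictions are the barycentres of the weights `η exp (η (L - η Q))`, so the weighted linearised
regrets sum to zero, and `exp (q - q ^ 2) ≤ 1 + q` makes the potential of the pairs (expert,
learning rate) non-increasing. Hence for each pair `∑ (η r - (η r) ^ 2) ≤ log (N K)`. Since
`exp (-q + q ^ 2) ≤ 1 - (q - 3 * q ^ 2)`, a supermartingale argument and a union bound over the
experts turn this, outside an event of probability at most `exp (-x)`, into a bound on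
`∑ E_{t-1}[η r - 3 (η r) ^ 2]`.

By weak exp-concavity and Young's inequality, the conditional regret of a deterministic point is at
most `E_{t-1}[r - 3 η r ^ 2]` plus a multiple of `ρ = (a / (α T)) ^ (1 / (2 - β))` when
`3 η ≤ α ρ ^ (1 - β)`. The prediction is random, whereas the assumption holds almost surely
separately at each point, and the gradients need not be continuous. The prediction is therefore
moved slightly towards the competitor and rounded to a finite net: the monotonicity of subgradients
controls the linearised regret under such a move. The rate closest to `a / (3 T ρ)` balances the
terms. If the grid has no rate that large, one pays the term `G a / T`; if it has none that small,
the square term is itself at most a multiple of `ρ`.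
-/

open Filter

/-! ### Scalar inequalities -/

theorem exp_sub_sq_le_one_add {q : ℝ} (hq : -(14 / 25) ≤ q) : Real.exp (q - q ^ 2) ≤ 1 + q := by
  rcases le_total 0 q with hq0 | hq0
  · have hlog : q - q ^ 2 ≤ 2 * q / (q + 2) := by
      rw [le_div_iff₀ (by linarith)]
      nlinarith [pow_nonneg hq0 2, pow_nonneg hq0 3]
    rw [← Real.le_log_iff_exp_le (by linarith)]
    exact hlog.trans (Real.le_log_one_add_of_nonneg hq0)
  · obtain ⟨p, rfl⟩ : ∃ p, q = -p := ⟨-q, by ring⟩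
    have hp0 : 0 ≤ p := by linarith
    have hp1 : p ≤ 14 / 25 := by linarith
    have hexp : 1 + (p + p ^ 2) + (p + p ^ 2) ^ 2 / 2 + (p + p ^ 2) ^ 3 / 6 ≤
        Real.exp (p + p ^ 2) := by
      simpa [Finset.sum_range_succ, Nat.factorial] using
        Real.sum_le_exp_of_nonneg (x := p + p ^ 2) (by positivity) 4
    have hpoly : 0 ≤ -p + (1 - p) * (1 + p) ^ 2 / 2 + p * ((1 - p) * (1 + p) ^ 3) / 6 := by
      have hone : 1 ≤ (1 - p) * (1 + p) ^ 3 := by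
        nlinarith [mul_nonneg hp0 (sub_nonneg.2 hp1), pow_nonneg hp0 2, pow_nonneg hp0 3]
      nlinarith [mul_le_mul_of_nonneg_left hone hp0, mul_nonneg hp0 (sub_nonneg.2 hp1),
        mul_nonneg (pow_nonneg hp0 2) (sub_nonneg.2 hp1)]
    have hprod : 1 ≤ (1 - p) * Real.exp (p + p ^ 2) := by
      nlinarith [mul_le_mul_of_nonneg_left hexp (by linarith : 0 ≤ 1 - p),
        mul_nonneg (sq_nonneg p) hpoly]
    rwa [show -p - (-p) ^ 2 = -(p + p ^ 2) by ring, Real.exp_neg, inv_le_iff_one_le_mul₀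
      (Real.exp_pos _), ← sub_eq_add_neg]

theorem exp_neg_add_sq_le {q : ℝ} (hq : |q| ≤ 2 / 5) :
    Real.exp (-q + q ^ 2) ≤ 1 - (q - 3 * q ^ 2) := by
  obtain ⟨hq1, hq2⟩ := abs_le.1 hq
  have hle : |-q + q ^ 2| ≤ 1 := abs_le.2 ⟨by nlinarith, by nlinarith⟩
  have hexp := (abs_le.1 (Real.abs_exp_sub_one_sub_id_le hle)).2
  have hsq : (1 - q) ^ 2 ≤ 2 := by nlinarith
  nlinarith [mul_le_mul_of_nonneg_left hsq (sq_nonneg q)]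

/-- Young's inequality with exponents `1 / β` and `1 / (1 - β)`, valid up to `β = 1`. -/
theorem rpow_one_sub_mul_le {z ρ β : ℝ} (hz : 0 ≤ z) (hρ : 0 ≤ ρ) (hβ : 0 < β) (hβ1 : β ≤ 1) :
    ρ ^ (1 - β) * z ≤ z ^ (1 / β) + ρ := by
  have hz' : (z ^ (1 / β)) ^ β = z := by
    rw [← Real.rpow_mul hz, one_div_mul_cancel hβ.ne', Real.rpow_one]
  calc ρ ^ (1 - β) * z = ρ ^ (1 - β) * (z ^ (1 / β)) ^ β := by rw [hz']
    _ ≤ (1 - β) * ρ + β * z ^ (1 / β) :=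
      Real.geom_mean_le_arith_mean2_weighted (by linarith) hβ.le hρ (by positivity) (by ring)
    _ ≤ z ^ (1 / β) + ρ := by nlinarith [Real.rpow_nonneg hz (1 / β)]

theorem sub_mul_sq_le_add {c y y' e : ℝ} (hy : |c * y| ≤ 1 / 4) (hy' : |c * y'| ≤ 1 / 4)
    (he : 0 ≤ e) (h : y' ≤ y + e) : y' - c * y' ^ 2 ≤ y - c * y ^ 2 + 2 * e := by
  obtain ⟨hy1, hy2⟩ := abs_le.1 hy
  obtain ⟨hy1', hy2'⟩ := abs_le.1 hy'
  calc y' - c * y' ^ 2 = y - c * y ^ 2 + (y' - y) * (1 - c * y - c * y') := by ring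
    _ ≤ y - c * y ^ 2 + e * 2 :=
      add_le_add_right (mul_le_mul (sub_le_iff_le_add'.2 h) (by linarith) (by linarith) he) _
    _ = y - c * y ^ 2 + 2 * e := by ring

/-! ### Covers of the unit ball -/

section CoveringNumber

variable {E : Type*} [NormedAddCommGroup E] [NormedSpace ℝ E] [FiniteDimensional ℝ E]
  {ε : NNReal} {R : ℝ}

-- Compare the volume of the disjoint balls of radius `ε / 2` with that of the ball of radius
-- `R + ε / 2` containing them.
theorem card_le_of_isSeparated_of_subset_closedBall (hε : 0 < ε) (hR : 0 ≤ R) {s : Finset E}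
    (hs : (s : Set E) ⊆ Metric.closedBall 0 R) (hsep : Metric.IsSeparated ε (s : Set E)) :
    (s.card : ℝ) ≤ (1 + 2 * R / ε) ^ Module.finrank ℝ E := by
  borelize E
  let μ : Measure E := Measure.addHaar
  have hδ : (0 : ℝ) < ε / 2 := by positivity
  have hρ : 0 < R + ε / 2 := by positivity
  have hdisj : (s : Set E).PairwiseDisjoint fun c => Metric.ball c (ε / 2 : ℝ) := by
    intro c hc c' hc' hne
    have hlt : (ε : ENNReal) < edist c c' := hsep hc hc' hne
    rw [edist_nndist, ENNReal.coe_lt_coe, ← NNReal.coe_lt_coe, coe_nndist] at hlt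
    exact Metric.ball_disjoint_ball (by linarith)
  have hsub : (⋃ c ∈ s, Metric.ball c (ε / 2 : ℝ)) ⊆ Metric.ball 0 (R + ε / 2) :=
    Set.iUnion₂_subset fun c hc => Metric.ball_subset_ball' <| by
      linarith [Metric.mem_closedBall.1 (hs hc)]
  have hvol : (s.card : ENNReal) * ENNReal.ofReal ((ε / 2 : ℝ) ^ Module.finrank ℝ E) *
      μ (Metric.ball 0 1) ≤
      ENNReal.ofReal ((R + ε / 2) ^ Module.finrank ℝ E) * μ (Metric.ball 0 1) :=
    calc _ = μ (⋃ c ∈ s, Metric.ball c (ε / 2 : ℝ)) := by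
          rw [measure_biUnion_finset hdisj fun c _ => Metric.isOpen_ball.measurableSet]
          simp only [μ.addHaar_ball_of_pos _ hδ, Finset.sum_const, nsmul_eq_mul, mul_assoc]
      _ ≤ μ (Metric.ball 0 (R + ε / 2)) := measure_mono hsub
      _ = _ := μ.addHaar_ball_of_pos _ hρ
  have hcard := ENNReal.toReal_le_of_le_ofReal (by positivity) ((ENNReal.mul_le_mul_iff_left
    (Metric.measure_ball_pos μ (0 : E) one_pos).ne' measure_ball_lt_top.ne).1 hvol)
  rw [ENNReal.toReal_mul, ENNReal.toReal_natCast, ENNReal.toReal_ofReal (by positivity)] at hcard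
  rwa [show 1 + 2 * R / ε = (R + ε / 2) / (ε / 2) by field_simp; ring, div_pow,
    le_div_iff₀ (by positivity)]

theorem coveringNumber_closedBall_le (hε : 0 < ε) (hR : 0 ≤ R) :
    Metric.coveringNumber ε (Metric.closedBall (0 : E) R) ≤
      (⌊(1 + 2 * R / ε) ^ Module.finrank ℝ E⌋₊ : ℕ) := by
  refine (Metric.coveringNumber_le_packingNumber _ _).trans ?_
  refine iSup_le fun C => iSup₂_le fun hC hsep => ?_
  by_contra! hlt
  obtain ⟨t, htC, ht⟩ := Set.exists_subset_encard_eq (Order.add_one_le_of_lt hlt)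
  have hfin : t.Finite := Set.finite_of_encard_eq_coe (k := _ + 1) (by rw [ht]; push_cast; rfl)
  lift t to Finset E using hfin
  have hcard := Nat.le_floor <| card_le_of_isSeparated_of_subset_closedBall hε hR
    (htC.trans hC) (hsep.mono htC)
  rw [Set.encard_coe_eq_coe_finsetCard] at ht
  have : t.card = ⌊(1 + 2 * R / ε) ^ Module.finrank ℝ E⌋₊ + 1 := by exact_mod_cast ht
  omega

end CoveringNumber

theorem finrank_param (d : ℕ) : Module.finrank ℝ (Param d) = d := by
  rw [(WithLp.linearEquiv 1 ℝ (Fin d → ℝ)).finrank_eq, Module.finrank_fin_fun]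

theorem IsMinimalCover.card_le {d : ℕ} {ε : NNReal} (hε : 0 < ε) {Θ₀ : Finset (Param d)}
    (h : IsMinimalCover ε Θ₀) : (Θ₀.card : ℝ) ≤ (1 + 2 / ε) ^ d := by
  have hle : (Θ₀.card : ℕ∞) ≤ _ :=
    h.2.2.le.trans (coveringNumber_closedBall_le (E := Param d) hε zero_le_one)
  have := (Nat.le_floor_iff (by positivity)).1 (Nat.cast_le.1 hle)
  rwa [finrank_param, mul_one] at this

/-! ### Linearised regret -/

section LinearizedRegret

variable {d : ℕ}

theorem mem_unitBall {θ : Param d} : θ ∈ unitBall d ↔ ‖θ‖ ≤ 1 := mem_closedBall_zero_iff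

theorem convex_unitBall (d : ℕ) : Convex ℝ (unitBall d) := convex_closedBall 0 1

theorem norm_sub_le_two_of_mem_unitBall {u v : Param d} (hu : u ∈ unitBall d)
    (hv : v ∈ unitBall d) : ‖u - v‖ ≤ 2 := by
  rw [mem_unitBall] at hu hv
  linarith [norm_sub_le u v]

theorem pairing_add (g : Fin d → ℝ) (u v : Param d) :
    pairing g (u + v) = pairing g u + pairing g v :=
  dotProduct_add g u.ofLp v.ofLp

theorem pairing_sub (g : Fin d → ℝ) (u v : Param d) :
    pairing g (u - v) = pairing g u - pairing g v :=
  dotProduct_sub g u.ofLp v.ofLp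

theorem pairing_smul (g : Fin d → ℝ) (c : ℝ) (v : Param d) :
    pairing g (c • v) = c * pairing g v :=
  dotProduct_smul c g v.ofLp

theorem pairing_sum {ι : Type*} (g : Fin d → ℝ) (s : Finset ι) (v : ι → Param d) :
    pairing g (∑ i ∈ s, v i) = ∑ i ∈ s, pairing g (v i) := by
  simpa only [pairing, dotProduct, WithLp.ofLp_sum] using dotProduct_sum g s fun i => (v i).ofLp

theorem abs_pairing_le {g : Fin d → ℝ} {G : ℝ} (hg : ‖g‖ ≤ G) (v : Param d) :
    |pairing g v| ≤ G * ‖v‖ := by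
  rw [PiLp.norm_eq_of_L1, Finset.mul_sum]
  refine (Finset.abs_sum_le_sum_abs _ _).trans (Finset.sum_le_sum fun i _ => ?_)
  rw [abs_mul, Real.norm_eq_abs]
  gcongr
  exact (norm_le_pi_norm g i).trans hg

/-- The linearised regret `g(u)ᵀ (u - w)` of the prediction `u` against `w`, where `g` is the
gradient oracle of the loss. -/
noncomputable def linearizedRegret (g : Param d → Fin d → ℝ) (u w : Param d) : ℝ :=
  pairing (g u) (u - w)

theorem abs_linearizedRegret_le {g : Param d → Fin d → ℝ} {G : ℝ} {u w : Param d}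
    (hg : ‖g u‖ ≤ G) (hu : u ∈ unitBall d) (hw : w ∈ unitBall d) :
    |linearizedRegret g u w| ≤ 2 * G := by
  have hG : 0 ≤ G := (norm_nonneg _).trans hg
  calc |linearizedRegret g u w| ≤ G * ‖u - w‖ := abs_pairing_le hg _
    _ ≤ G * 2 := by gcongr; exact norm_sub_le_two_of_mem_unitBall hu hw
    _ = 2 * G := mul_comm _ _

end LinearizedRegret

/-! ### Regret of the algorithm -/

theorem learningRate_pos {E : ℝ} (hE : 0 < E) (i : ℕ) : 0 < learningRate E i := by
  unfold learningRate; positivity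

theorem learningRate_mul_exp {E : ℝ} (hE : 0 < E) (i : ℕ) :
    learningRate E i * (Real.exp i * E) = 1 :=
  inv_mul_cancel₀ (by positivity)

theorem learningRate_anti {E : ℝ} (hE : 0 < E) : Antitone (learningRate E) := fun i j hij => by
  unfold learningRate
  gcongr

section Squint

variable {d : ℕ} {Θ₀ : Finset (Param d)} {prior : Param d → ℝ} {E : ℝ} {N : ℕ}

theorem rawWeight_pos (hE : 0 < E) (hN : 1 ≤ N) {p : ℝ} (hp : 0 < p) (L Q : ℝ) :
    0 < rawWeight E N p L Q :=
  Finset.sum_pos (fun i _ => by have := learningRate_pos hE i; positivity)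
    (Finset.nonempty_Icc.2 hN)

theorem sum_rawWeight_pos (hΘ : Θ₀.Nonempty) (hp : ∀ θ ∈ Θ₀, 0 < prior θ) (hE : 0 < E)
    (hN : 1 ≤ N) (S : Param d → ℝ × ℝ) :
    0 < ∑ ϑ ∈ Θ₀, rawWeight E N (prior ϑ) (S ϑ).1 (S ϑ).2 :=
  Finset.sum_pos (fun θ hθ => rawWeight_pos hE hN (hp θ hθ) _ _) hΘ

theorem aggregate_mem {s : Set (Param d)} (hs : Convex ℝ s) (hΘ : Θ₀.Nonempty)
    (hΘs : (Θ₀ : Set (Param d)) ⊆ s) (hp : ∀ θ ∈ Θ₀, 0 < prior θ) (hE : 0 < E) (hN : 1 ≤ N)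
    (S : Param d → ℝ × ℝ) : aggregate Θ₀ prior E N S ∈ s := by
  have hZ := sum_rawWeight_pos hΘ hp hE hN S
  refine hs.sum_mem (fun θ hθ => ?_) ?_ fun θ hθ => hΘs hθ
  · exact div_nonneg (rawWeight_pos hE hN (hp θ hθ) _ _).le hZ.le
  · rw [← Finset.sum_div, div_self hZ.ne']

theorem sum_rawWeight_mul_pairing (hΘ : Θ₀.Nonempty) (hp : ∀ θ ∈ Θ₀, 0 < prior θ) (hE : 0 < E)
    (hN : 1 ≤ N) (S : Param d → ℝ × ℝ) (g : Fin d → ℝ) :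
    ∑ θ ∈ Θ₀, rawWeight E N (prior θ) (S θ).1 (S θ).2 *
      pairing g (aggregate Θ₀ prior E N S - θ) = 0 := by
  have hZ := sum_rawWeight_pos hΘ hp hE hN S
  simp only [pairing_sub, mul_sub, Finset.sum_sub_distrib, ← Finset.sum_mul]
  rw [aggregate, pairing_sum, Finset.mul_sum, sub_eq_zero]
  refine Finset.sum_congr rfl fun θ _ => ?_
  rw [pairing_smul]
  field_simp

/-- The linearised regret of the algorithm against `θ` in round `t + 1`; the paper's
`r_{k, t + 1}` for `θ = θ_k`. -/
noncomputable def instantRegret (Θ₀ : Finset (Param d)) (prior : Param d → ℝ) (E : ℝ) (N : ℕ)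
    (grad : ℕ → Param d → Fin d → ℝ) (t : ℕ) (θ : Param d) : ℝ :=
  linearizedRegret (grad (t + 1)) (squint Θ₀ prior E N grad t) θ

theorem squintState_succ (grad : ℕ → Param d → Fin d → ℝ) (t : ℕ) :
    squintState Θ₀ prior E N grad (t + 1) = fun θ =>
      ((squintState Θ₀ prior E N grad t θ).1 + instantRegret Θ₀ prior E N grad t θ,
        (squintState Θ₀ prior E N grad t θ).2 + instantRegret Θ₀ prior E N grad t θ ^ 2) :=
  rfl

theorem squintState_eq_sum (grad : ℕ → Param d → Fin d → ℝ) (t : ℕ) (θ : Param d) :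
    squintState Θ₀ prior E N grad t θ =
      (∑ s ∈ Finset.range t, instantRegret Θ₀ prior E N grad s θ,
        ∑ s ∈ Finset.range t, instantRegret Θ₀ prior E N grad s θ ^ 2) := by
  induction t with
  | zero => rfl
  | succ t ih => simp only [squintState_succ, ih, Finset.sum_range_succ]

/-- The potential of the algorithm: the sum of the weights `p exp (η (L - η Q))` of all pairs of
an expert and a learning rate. Unlike in `rawWeight`, there is no factor `η`: it appears in the
first-order variation of the potential. -/
noncomputable def squintPotential (Θ₀ : Finset (Param d)) (prior : Param d → ℝ) (E : ℝ) (N : ℕ)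
    (S : Param d → ℝ × ℝ) : ℝ :=
  ∑ θ ∈ Θ₀, ∑ i ∈ Finset.Icc 1 N,
    prior θ * Real.exp (learningRate E i * ((S θ).1 - learningRate E i * (S θ).2))

theorem exp_mul_update_le {η r : ℝ} (hr : -(14 / 25) ≤ η * r) (L Q : ℝ) :
    Real.exp (η * (L + r - η * (Q + r ^ 2))) ≤
      Real.exp (η * (L - η * Q)) + η * Real.exp (η * (L - η * Q)) * r := by
  rw [show η * (L + r - η * (Q + r ^ 2)) = η * (L - η * Q) + (η * r - (η * r) ^ 2) by ring,
    Real.exp_add]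
  calc _ ≤ Real.exp (η * (L - η * Q)) * (1 + η * r) := by gcongr; exact exp_sub_sq_le_one_add hr
    _ = _ := by ring

theorem squintPotential_update_le (hp : ∀ θ ∈ Θ₀, 0 < prior θ) (S : Param d → ℝ × ℝ)
    {r : Param d → ℝ}
    (hr : ∀ θ ∈ Θ₀, ∀ i ∈ Finset.Icc 1 N, -(14 / 25) ≤ learningRate E i * r θ) :
    squintPotential Θ₀ prior E N (fun θ => ((S θ).1 + r θ, (S θ).2 + r θ ^ 2)) ≤
      squintPotential Θ₀ prior E N S +
        ∑ θ ∈ Θ₀, rawWeight E N (prior θ) (S θ).1 (S θ).2 * r θ := by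
  simp only [squintPotential, rawWeight, ← Finset.sum_add_distrib, Finset.sum_mul]
  gcongr with θ hθ i hi
  calc _ ≤ prior θ * _ :=
        mul_le_mul_of_nonneg_left (exp_mul_update_le (hr θ hθ i hi) _ _) (hp θ hθ).le
    _ = _ := by ring

theorem squintPotential_le_sum_prior (hΘ : Θ₀.Nonempty) (hp : ∀ θ ∈ Θ₀, 0 < prior θ)
    (hE : 0 < E) (hN : 1 ≤ N) (grad : ℕ → Param d → Fin d → ℝ) (T : ℕ)
    (hr : ∀ t < T, ∀ θ ∈ Θ₀, ∀ i ∈ Finset.Icc 1 N,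
      -(14 / 25) ≤ learningRate E i * instantRegret Θ₀ prior E N grad t θ) :
    squintPotential Θ₀ prior E N (squintState Θ₀ prior E N grad T) ≤ N * ∑ θ ∈ Θ₀, prior θ := by
  induction T with
  | zero => simp [squintPotential, squintState, Finset.mul_sum]
  | succ T ih =>
    have hsum := sum_rawWeight_mul_pairing hΘ hp hE hN (squintState Θ₀ prior E N grad T)
      (grad (T + 1) (squint Θ₀ prior E N grad T))
    calc _ ≤ squintPotential Θ₀ prior E N (squintState Θ₀ prior E N grad T) + 0 :=
          (squintPotential_update_le hp _ (hr T T.lt_succ_self)).trans_eq (congrArg _ hsum)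
      _ ≤ _ := (add_zero _).trans_le (ih fun t ht => hr t (ht.trans T.lt_succ_self))

theorem prior_mul_exp_le_squintPotential (hp : ∀ θ ∈ Θ₀, 0 < prior θ) (S : Param d → ℝ × ℝ)
    {θ : Param d} (hθ : θ ∈ Θ₀) {i : ℕ} (hi : i ∈ Finset.Icc 1 N) :
    prior θ * Real.exp (learningRate E i * ((S θ).1 - learningRate E i * (S θ).2)) ≤
      squintPotential Θ₀ prior E N S := by
  let w : Param d → ℕ → ℝ := fun ϑ j =>
    prior ϑ * Real.exp (learningRate E j * ((S ϑ).1 - learningRate E j * (S ϑ).2))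
  have hw : ∀ ϑ ∈ Θ₀, ∀ j, 0 ≤ w ϑ j := fun ϑ hϑ j => mul_nonneg (hp ϑ hϑ).le (Real.exp_pos _).le
  calc w θ i ≤ ∑ j ∈ Finset.Icc 1 N, w θ j := Finset.single_le_sum (fun j _ => hw θ hθ j) hi
    _ ≤ squintPotential Θ₀ prior E N S :=
      Finset.single_le_sum (f := fun ϑ => ∑ j ∈ Finset.Icc 1 N, w ϑ j)
        (fun ϑ hϑ => Finset.sum_nonneg fun j _ => hw ϑ hϑ j) hθ

theorem sum_instantRegret_sub_sq_le (hp : ∀ θ ∈ Θ₀, 0 < prior θ) (hE : 0 < E)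
    (grad : ℕ → Param d → Fin d → ℝ) (T : ℕ)
    (hr : ∀ t < T, ∀ θ ∈ Θ₀, -(3 / 2 * E) ≤ instantRegret Θ₀ prior E N grad t θ)
    {θ : Param d} (hθ : θ ∈ Θ₀) {i : ℕ} (hi : i ∈ Finset.Icc 1 N) :
    ∑ t ∈ Finset.range T, (learningRate E i * instantRegret Θ₀ prior E N grad t θ -
      (learningRate E i * instantRegret Θ₀ prior E N grad t θ) ^ 2) ≤
      Real.log (N * (∑ ϑ ∈ Θ₀, prior ϑ) / prior θ) := by
  have hN : 1 ≤ N := (Finset.mem_Icc.1 hi).1.trans (Finset.mem_Icc.1 hi).2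
  have hscaled : ∀ t < T, ∀ θ ∈ Θ₀, ∀ j ∈ Finset.Icc 1 N,
      -(14 / 25) ≤ learningRate E j * instantRegret Θ₀ prior E N grad t θ := by
    intro t ht θ hθ j hj
    have hη := learningRate_pos hE j
    have hη1 : learningRate E j * (Real.exp 1 * E) ≤ 1 := by
      simpa using (mul_le_mul_of_nonneg_right (learningRate_anti hE (Finset.mem_Icc.1 hj).1)
        (by positivity)).trans_eq (learningRate_mul_exp hE 1)
    nlinarith [mul_le_mul_of_nonneg_left (hr t ht θ hθ) hη.le,
      mul_le_mul_of_nonneg_right Real.exp_one_gt_d9.le (mul_pos hη hE).le]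
  have hweight : prior θ * Real.exp (learningRate E i *
      ((squintState Θ₀ prior E N grad T θ).1 -
        learningRate E i * (squintState Θ₀ prior E N grad T θ).2)) ≤
      N * ∑ ϑ ∈ Θ₀, prior ϑ :=
    (prior_mul_exp_le_squintPotential hp _ hθ hi).trans
      (squintPotential_le_sum_prior ⟨θ, hθ⟩ hp hE hN grad T hscaled)
  have hprior : 0 < ∑ ϑ ∈ Θ₀, prior ϑ := Finset.sum_pos hp ⟨θ, hθ⟩
  rw [mul_comm (prior θ), ← le_div_iff₀ (hp θ hθ), squintState_eq_sum,
    ← Real.le_log_iff_exp_le (by have := hp θ hθ; positivity)] at hweight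
  refine le_trans (le_of_eq ?_) hweight
  simp only [Finset.sum_sub_distrib, mul_pow, ← Finset.mul_sum]
  ring

end Squint

/-! ### Measurability of the predictions -/

section Measurability

variable {Ω : Type*} {m m0 : MeasurableSpace Ω} {d : ℕ} {Θ₀ : Finset (Param d)}
  {prior : Param d → ℝ} {E : ℝ} {N : ℕ}

theorem measurable_pairing {g : Ω → Fin d → ℝ} {v : Ω → Param d} (hg : Measurable[m] g)
    (hv : Measurable[m] v) : Measurable[m] fun ω => pairing (g ω) (v ω) :=
  Finset.measurable_fun_sum _ fun i _ => ((measurable_pi_apply i).comp hg).mul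
    ((measurable_pi_apply i).comp ((WithLp.measurable_ofLp 1 (Fin d → ℝ)).comp hv))

theorem measurable_linearizedRegret {g : Ω → Param d → Fin d → ℝ}
    (hg : Measurable[m.prod inferInstance] fun q : Ω × Param d => g q.1 q.2) {p : Ω → Param d}
    (hp : Measurable[m] p) (w : Param d) :
    Measurable[m] fun ω => linearizedRegret (g ω) (p ω) w :=
  measurable_pairing (hg.comp (measurable_id.prodMk hp)) (hp.sub_const w)

theorem measurable_aggregate {S : Ω → Param d → ℝ × ℝ} (hS : ∀ θ, Measurable[m] fun ω => S ω θ) :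
    Measurable[m] fun ω => aggregate Θ₀ prior E N (S ω) := by
  have hweight (θ : Param d) :
      Measurable[m] fun ω => rawWeight E N (prior θ) (S ω θ).1 (S ω θ).2 := by
    have := hS θ
    unfold rawWeight
    fun_prop
  exact Finset.measurable_fun_sum _ fun θ _ =>
    ((hweight θ).div (Finset.measurable_fun_sum _ fun ϑ _ => hweight ϑ)).smul_const θ

theorem measurable_of_prod_le {X Y : Type*} [MeasurableSpace X] [MeasurableSpace Y] (hm : m ≤ m0)
    {f : Ω × X → Y} (hf : Measurable[m.prod inferInstance] f) : Measurable f :=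
  hf.mono (sup_le_sup (MeasurableSpace.comap_mono hm) le_rfl) le_rfl

/-- The gradient oracle of round `t + 1` is measurable for the information at the end of that
round, jointly in the outcome and the point; the value in round `0` is irrelevant. -/
def IsAdaptedOracle (ℱ : Filtration ℕ m0) (grad : ℕ → Ω → Param d → Fin d → ℝ) : Prop :=
  ∀ t, Measurable[(ℱ (t + 1)).prod inferInstance] fun q : Ω × Param d => grad (t + 1) q.1 q.2

variable {ℱ : Filtration ℕ m0} {grad : ℕ → Ω → Param d → Fin d → ℝ}

theorem measurable_squintState (hgrad : IsAdaptedOracle ℱ grad) (t : ℕ) (θ : Param d) :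
    Measurable[ℱ t] fun ω => squintState Θ₀ prior E N (fun s => grad s ω) t θ := by
  induction t generalizing θ with
  | zero => exact measurable_const
  | succ t ih =>
    have hstate (ϑ : Param d) : Measurable[ℱ (t + 1)]
        fun ω => squintState Θ₀ prior E N (fun s => grad s ω) t ϑ :=
      (ih ϑ).mono (ℱ.mono t.le_succ) le_rfl
    have hregret : Measurable[ℱ (t + 1)]
        fun ω => instantRegret Θ₀ prior E N (fun s => grad s ω) t θ :=
      measurable_linearizedRegret (hgrad t) (measurable_aggregate hstate) θ
    exact ((hstate θ).fst.add hregret).prodMk ((hstate θ).snd.add (hregret.pow_const 2))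

theorem measurable_squint (hgrad : IsAdaptedOracle ℱ grad) (t : ℕ) :
    Measurable[ℱ t] fun ω => squint Θ₀ prior E N (fun s => grad s ω) t :=
  measurable_aggregate (measurable_squintState hgrad t)

theorem measurable_instantRegret (hgrad : IsAdaptedOracle ℱ grad) (t : ℕ) (θ : Param d) :
    Measurable[ℱ (t + 1)] fun ω => instantRegret Θ₀ prior E N (fun s => grad s ω) t θ :=
  measurable_linearizedRegret (hgrad t)
    ((measurable_squint hgrad t).mono (ℱ.mono t.le_succ) le_rfl) θ

end Measurability

/-! ### Concentration of sums of conditional expectations -/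

section Supermartingale

variable {Ω : Type*} {m m0 : MeasurableSpace Ω} {P : Measure Ω}

theorem condExp_le_const [IsFiniteMeasure P] (hm : m ≤ m0) {f : Ω → ℝ} (hf : Integrable f P) {c : ℝ}
    (hfc : ∀ᵐ ω ∂P, f ω ≤ c) : ∀ᵐ ω ∂P, (P[f | m]) ω ≤ c := by
  have hmono := condExp_mono (m := m) hf (integrable_const c) hfc
  rwa [condExp_const hm] at hmono

variable {ℱ : Filtration ℕ m0} {u b : ℕ → Ω → ℝ} {B : ℝ}

/-- The process `∏_{s < t} exp (E[u_s | ℱ_s] - b_s)`, written as the exponential of a sum. It is a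
supermartingale when `exp (-b_s) ≤ 1 - u_s`. -/
noncomputable def expCompensated (P : Measure Ω) (ℱ : Filtration ℕ m0) (u b : ℕ → Ω → ℝ) (t : ℕ)
    (ω : Ω) : ℝ :=
  Real.exp (∑ s ∈ Finset.range t, ((P[u s | ℱ s]) ω - b s ω))

theorem stronglyAdapted_expCompensated (hb : ∀ t, Measurable[ℱ (t + 1)] (b t)) :
    StronglyAdapted ℱ (expCompensated P ℱ u b) := fun _ =>
  Real.continuous_exp.comp_stronglyMeasurable <| Finset.stronglyMeasurable_fun_sum _ fun s hs =>
    (stronglyMeasurable_condExp.mono (ℱ.mono (Finset.mem_range.1 hs).le)).sub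
      ((hb s).stronglyMeasurable.mono (ℱ.mono (Finset.mem_range.1 hs)))

variable [IsProbabilityMeasure P]

theorem integrable_expCompensated (hb : ∀ t, Measurable[ℱ (t + 1)] (b t))
    (hbB : ∀ t, ∀ᵐ ω ∂P, -B ≤ b t ω) (hu : ∀ t, Integrable (u t) P)
    (hub : ∀ t, ∀ᵐ ω ∂P, Real.exp (-b t ω) ≤ 1 - u t ω) (t : ℕ) :
    Integrable (expCompensated P ℱ u b t) P := by
  have hstep (s : ℕ) : ∀ᵐ ω ∂P, (P[u s | ℱ s]) ω - b s ω ≤ 1 + B := by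
    have hu1 : ∀ᵐ ω ∂P, u s ω ≤ 1 := (hub s).mono fun ω h => by
      linarith [Real.exp_pos (-b s ω)]
    filter_upwards [condExp_le_const (ℱ.le s) (hu s) hu1, hbB s] with ω h1 h2
    linarith
  refine .of_bound ((stronglyAdapted_expCompensated hb t).mono (ℱ.le t)).aestronglyMeasurable
    (Real.exp (t * (1 + B))) ?_
  filter_upwards [ae_all_iff.2 hstep] with ω h
  rw [expCompensated, Real.norm_eq_abs, Real.abs_exp, Real.exp_le_exp]
  exact (Finset.sum_le_card_nsmul _ _ _ fun s _ => h s).trans_eq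
    (by rw [Finset.card_range, nsmul_eq_mul])

theorem supermartingale_expCompensated (hb : ∀ t, Measurable[ℱ (t + 1)] (b t))
    (hbB : ∀ t, ∀ᵐ ω ∂P, -B ≤ b t ω) (hu : ∀ t, Integrable (u t) P)
    (hub : ∀ t, ∀ᵐ ω ∂P, Real.exp (-b t ω) ≤ 1 - u t ω) :
    Supermartingale (expCompensated P ℱ u b) ℱ P := by
  have hint := integrable_expCompensated hb hbB hu hub
  refine supermartingale_nat (stronglyAdapted_expCompensated hb) hint fun t => ?_
  let c := P[u t | ℱ t]
  let g : Ω → ℝ := fun ω => Real.exp (-b t ω)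
  have hsplit : expCompensated P ℱ u b (t + 1) =
      (fun ω => expCompensated P ℱ u b t ω * Real.exp (c ω)) * g := by
    ext ω
    simp only [expCompensated, Finset.sum_range_succ, Pi.mul_apply, c, g, ← Real.exp_add]
    ring_nf
  have hmeas : StronglyMeasurable[ℱ t] fun ω => expCompensated P ℱ u b t ω * Real.exp (c ω) :=
    (stronglyAdapted_expCompensated hb t).mul
      (Real.continuous_exp.comp_stronglyMeasurable stronglyMeasurable_condExp)
  have hg : Integrable g P := by
    refine .of_bound (Real.measurable_exp.comp
      ((hb t).mono (ℱ.le _) le_rfl).neg).aestronglyMeasurable (Real.exp B) ?_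
    filter_upwards [hbB t] with ω h
    rw [Real.norm_eq_abs, Real.abs_exp, Real.exp_le_exp]
    linarith
  have hgc : P[g | ℱ t] ≤ᵐ[P] fun ω => 1 - c ω := by
    filter_upwards [condExp_mono (m := ℱ t) hg ((integrable_const (1 : ℝ)).sub (hu t)) (hub t),
      condExp_sub (integrable_const (1 : ℝ)) (hu t) (ℱ t)] with ω hmono hsub
    rwa [hsub, Pi.sub_apply, condExp_const (ℱ.le t)] at hmono
  have hpull := condExp_mul_of_stronglyMeasurable_left hmeas (hsplit ▸ hint (t + 1)) hg
  rw [hsplit]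
  filter_upwards [hpull, hgc] with ω hpull hgc
  have hM : 0 < expCompensated P ℱ u b t ω := Real.exp_pos _
  rw [hpull, Pi.mul_apply, mul_assoc]
  refine mul_le_of_le_one_right hM.le ?_
  calc Real.exp (c ω) * (P[g | ℱ t]) ω ≤ Real.exp (c ω) * Real.exp (-c ω) := by
        gcongr
        linarith [Real.add_one_le_exp (-c ω)]
    _ = 1 := by rw [← Real.exp_add, add_neg_cancel, Real.exp_zero]

theorem integral_expCompensated_le_one (hb : ∀ t, Measurable[ℱ (t + 1)] (b t))
    (hbB : ∀ t, ∀ᵐ ω ∂P, -B ≤ b t ω) (hu : ∀ t, Integrable (u t) P)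
    (hub : ∀ t, ∀ᵐ ω ∂P, Real.exp (-b t ω) ≤ 1 - u t ω) (t : ℕ) :
    ∫ ω, expCompensated P ℱ u b t ω ∂P ≤ 1 := by
  simpa [expCompensated] using (supermartingale_expCompensated hb hbB hu hub).setIntegral_le
    t.zero_le MeasurableSet.univ

theorem measureReal_lt_sum_condExp_sub_le (hb : ∀ t, Measurable[ℱ (t + 1)] (b t))
    (hbB : ∀ t, ∀ᵐ ω ∂P, -B ≤ b t ω) (hu : ∀ t, Integrable (u t) P)
    (hub : ∀ t, ∀ᵐ ω ∂P, Real.exp (-b t ω) ≤ 1 - u t ω) (T : ℕ) (y : ℝ) :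
    P.real {ω | y < ∑ t ∈ Finset.range T, ((P[u t | ℱ t]) ω - b t ω)} ≤ Real.exp (-y) := by
  have hmarkov := mul_meas_ge_le_integral_of_nonneg (μ := P)
    (Eventually.of_forall fun ω => (Real.exp_pos _).le)
    (integrable_expCompensated hb hbB hu hub T) (Real.exp y)
  rw [Real.exp_neg, ← one_div, le_div_iff₀' (Real.exp_pos y)]
  refine le_trans ?_ (hmarkov.trans (integral_expCompensated_le_one hb hbB hu hub T))
  gcongr with ω
  · finiteness
  · exact fun h => (Real.exp_le_exp.2 h.le : _)

theorem measureReal_lt_sum_condExp_sub_sq_le {X : ℕ → Ω → ℝ}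
    (hX : ∀ t, Measurable[ℱ (t + 1)] (X t)) (hX1 : ∀ t, ∀ᵐ ω ∂P, |X t ω| ≤ 2 / 5) (T : ℕ) (y : ℝ) :
    P.real {ω | y < ∑ t ∈ Finset.range T,
      ((P[fun ω' => X t ω' - 3 * X t ω' ^ 2 | ℱ t]) ω - (X t ω - X t ω ^ 2))} ≤ Real.exp (-y) := by
  refine measureReal_lt_sum_condExp_sub_le (B := 1) (fun t => (hX t).sub ((hX t).pow_const 2))
    (fun t => ?_) (fun t => ?_) (fun t => ?_) T y
  · filter_upwards [hX1 t] with ω h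
    obtain ⟨h1, h2⟩ := abs_le.1 h
    rw [Pi.sub_apply]
    nlinarith
  · have hXm : Measurable (X t) := (hX t).mono (ℱ.le _) le_rfl
    refine .of_bound (hXm.sub ((hXm.pow_const 2).const_mul 3)).aestronglyMeasurable 1 ?_
    filter_upwards [hX1 t] with ω h
    obtain ⟨h1, h2⟩ := abs_le.1 h
    exact abs_le.2 ⟨by nlinarith, by nlinarith⟩
  · filter_upwards [hX1 t] with ω h
    simpa only [Pi.sub_apply, neg_sub, neg_add_eq_sub] using exp_neg_add_sq_le h

theorem exists_event_sum_condExp_le {ι : Type*} (s : Finset ι) {X : ι → ℕ → Ω → ℝ}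
    (hX : ∀ k ∈ s, ∀ t, Measurable[ℱ (t + 1)] (X k t))
    (hX1 : ∀ k ∈ s, ∀ t, ∀ᵐ ω ∂P, |X k t ω| ≤ 2 / 5) (T : ℕ) (x : ℝ) :
    ∃ A : Set Ω, MeasurableSet A ∧ 1 - Real.exp (-x) ≤ P.real A ∧ ∀ ω ∈ A, ∀ k ∈ s,
      ∑ t ∈ Finset.range T, (P[fun ω' => X k t ω' - 3 * X k t ω' ^ 2 | ℱ t]) ω ≤
        ∑ t ∈ Finset.range T, (X k t ω - X k t ω ^ 2) + Real.log s.card + x := by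
  let bad : ι → Set Ω := fun k => {ω | Real.log s.card + x < ∑ t ∈ Finset.range T,
    ((P[fun ω' => X k t ω' - 3 * X k t ω' ^ 2 | ℱ t]) ω - (X k t ω - X k t ω ^ 2))}
  have hmeas : MeasurableSet (⋃ k ∈ s, bad k) := s.measurableSet_biUnion fun k hk =>
    measurableSet_lt measurable_const <| Finset.measurable_fun_sum _ fun t _ =>
      (stronglyMeasurable_condExp.mono (ℱ.le t)).measurable.sub
        (((hX k hk t).sub ((hX k hk t).pow_const 2)).mono (ℱ.le _) le_rfl)
  have hbad : ∀ k ∈ s, P.real (bad k) ≤ (s.card : ℝ)⁻¹ * Real.exp (-x) := by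
    intro k hk
    have hcard : (0 : ℝ) < s.card := by exact_mod_cast Finset.card_pos.2 ⟨k, hk⟩
    refine (measureReal_lt_sum_condExp_sub_sq_le (hX k hk) (hX1 k hk) T _).trans_eq ?_
    rw [neg_add, Real.exp_add, ← Real.log_inv, Real.exp_log (by positivity)]
  have hunion : P.real (⋃ k ∈ s, bad k) ≤ Real.exp (-x) :=
    calc _ ≤ ∑ k ∈ s, P.real (bad k) := measureReal_biUnion_finset_le s bad
      _ ≤ s.card * ((s.card : ℝ)⁻¹ * Real.exp (-x)) := by simpa using Finset.sum_le_sum hbad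
      _ ≤ 1 * Real.exp (-x) := by
        rw [← mul_assoc]
        gcongr
        exact mul_inv_le_one
      _ = Real.exp (-x) := one_mul _
  refine ⟨(⋃ k ∈ s, bad k)ᶜ, hmeas.compl, ?_, fun ω hω k hk => ?_⟩
  · rw [probReal_compl_eq_one_sub hmeas]
    linarith
  · have hle : ω ∉ bad k := fun h => hω (Set.mem_biUnion hk h)
    rw [Set.mem_ofPred_eq, not_lt, Finset.sum_sub_distrib] at hle
    linarith

end Supermartingale

/-! ### Conditional inequalities at random points -/

theorem exists_simpleFunc_dist_le {X : Type*} [PseudoMetricSpace X] [MeasurableSpace X]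
    [OpensMeasurableSpace X] {K : Set X} (hK : IsCompact K) (hne : K.Nonempty) {ε : ℝ}
    (hε : 0 < ε) :
    ∃ φ : SimpleFunc X X, (∀ x, φ x ∈ K) ∧ ∀ x ∈ K, dist (φ x) x ≤ ε := by
  obtain ⟨t, htK, htfin, htcov⟩ := hK.finite_cover_balls hε
  have htne : t.Nonempty := by
    obtain ⟨x, hx⟩ := hne
    obtain ⟨y, hy, -⟩ := Set.mem_iUnion₂.1 (htcov hx)
    exact ⟨y, hy⟩
  obtain ⟨e, rfl⟩ := htfin.countable.exists_eq_range htne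
  obtain ⟨M, hM⟩ : ∃ M, ∀ y ∈ Set.range e, ∃ k ≤ M, e k = y := by
    choose! k hk using fun y (hy : y ∈ Set.range e) => hy
    exact ⟨htfin.toFinset.sup k, fun y hy =>
      ⟨k y, Finset.le_sup (htfin.mem_toFinset.2 hy), hk y hy⟩⟩
  refine ⟨SimpleFunc.nearestPt e M, fun x => htK ⟨_, rfl⟩, fun x hx => ?_⟩
  obtain ⟨y, hy, hxy⟩ := Set.mem_iUnion₂.1 (htcov hx)
  obtain ⟨k, hkM, rfl⟩ := hM y hy
  have hnear := SimpleFunc.edist_nearestPt_le e x hkM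
  rw [edist_dist, edist_dist, ENNReal.ofReal_le_ofReal_iff dist_nonneg] at hnear
  exact hnear.trans (Metric.mem_ball'.1 hxy).le

section FiniteRange

variable {Ω X E : Type*} {s : Finset X} {ψ : Ω → X}

theorem comp_eq_sum_indicator [AddCommMonoid E] (hψs : ∀ ω, ψ ω ∈ s) (f : Ω → X → E) :
    (fun ω => f ω (ψ ω)) = ∑ x ∈ s, (ψ ⁻¹' {x}).indicator fun ω => f ω x := by
  ext ω
  rw [Finset.sum_apply, Finset.sum_eq_single_of_mem (ψ ω) (hψs ω)]
  · exact (Set.indicator_of_mem rfl _).symm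
  · exact fun x _ hx => Set.indicator_of_notMem (fun h => hx h.symm) _

variable {m m0 : MeasurableSpace Ω} {P : Measure Ω} [MeasurableSpace X]
  [MeasurableSingletonClass X] [NormedAddCommGroup E]

theorem integrable_comp_of_mem_finset (hψ : Measurable ψ) (hψs : ∀ ω, ψ ω ∈ s) {f : Ω → X → E}
    (hf : ∀ x ∈ s, Integrable (fun ω => f ω x) P) : Integrable (fun ω => f ω (ψ ω)) P := by
  rw [comp_eq_sum_indicator hψs]
  exact integrable_finsetSum' _ fun x hx => (hf x hx).indicator (hψ (measurableSet_singleton x))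

theorem condExp_comp_of_mem_finset [NormedSpace ℝ E] [CompleteSpace E] (hm : m ≤ m0)
    (hψ : Measurable[m] ψ) (hψs : ∀ ω, ψ ω ∈ s) {f : Ω → X → E}
    (hf : ∀ x ∈ s, Integrable (fun ω => f ω x) P) :
    P[fun ω => f ω (ψ ω) | m] =ᵐ[P] fun ω => (P[fun ω' => f ω' (ψ ω) | m]) ω := by
  have hfiber (x : X) : MeasurableSet[m] (ψ ⁻¹' {x}) := hψ (measurableSet_singleton x)
  have hsum := condExp_finsetSum (fun x hx => (hf x hx).indicator (hm _ (hfiber x))) m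
  have hindicator := (Finset.eventually_all s).2 fun x hx => condExp_indicator (hf x hx) (hfiber x)
  rw [comp_eq_sum_indicator hψs]
  filter_upwards [hsum, hindicator] with ω hsum hindicator
  rw [hsum, Finset.sum_apply, Finset.sum_congr rfl hindicator]
  simpa using (congrFun (comp_eq_sum_indicator hψs fun ω x => (P[fun ω' => f ω' x | m]) ω) ω).symm

end FiniteRange

section Subgradient

variable {d : ℕ} {f : Param d → ℝ} {g : Param d → Fin d → ℝ} {G : ℝ}

theorem IsSubgradientAt.sub_le {u : Param d} {a : Fin d → ℝ} (hsub : IsSubgradientAt f u a)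
    (v : Param d) : f u - f v ≤ pairing a (u - v) := by
  have h := hsub v
  rw [pairing_sub] at h ⊢
  linarith

theorem IsSubgradientAt.pairing_le {u v : Param d} {a b : Fin d → ℝ} (hu : IsSubgradientAt f u a)
    (hv : IsSubgradientAt f v b) : pairing a (v - u) ≤ pairing b (v - u) := by
  linarith [hu v, hv.sub_le u]

theorem IsSubgradientAt.sub_le_mul_norm {u : Param d} {a : Fin d → ℝ}
    (hsub : IsSubgradientAt f u a) (ha : ‖a‖ ≤ G) (v : Param d) : f u - f v ≤ G * ‖u - v‖ :=
  (hsub.sub_le v).trans (abs_le.1 (abs_pairing_le ha _)).2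

/-- The regret `f u - f w` in excess of its second-order surrogate `r - c r²`, where `r` is the
linearised regret; weak exp-concavity makes its conditional expectation small. -/
noncomputable def surrogateGap (c : ℝ) (f : Param d → ℝ) (g : Param d → Fin d → ℝ)
    (u w : Param d) : ℝ :=
  f u - f w - (linearizedRegret g u w - c * linearizedRegret g u w ^ 2)

variable {κ : ℝ} {p q w : Param d}

/- No continuity of `g` is available. Monotonicity of subgradients compares `g q` and `g p` in
the direction `q - p`, which is close to `κ (w - p)`. -/
theorem linearizedRegret_le_add (hp : IsSubgradientAt f p (g p)) (hq : IsSubgradientAt f q (g q))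
    (hgp : ‖g p‖ ≤ G) (hgq : ‖g q‖ ≤ G) (hκ : 0 < κ) (hκ1 : κ ≤ 1) (hpw : ‖p - w‖ ≤ 2)
    (hqp : ‖q - (p + κ • (w - p))‖ ≤ κ ^ 2) :
    ‖q - p‖ ≤ 3 * κ ∧ linearizedRegret g q w ≤ linearizedRegret g p w + 5 * G * κ := by
  have hG : 0 ≤ G := (norm_nonneg _).trans hgp
  obtain ⟨e, rfl⟩ : ∃ e, q = p + e - κ • (p - w) := ⟨q - (p + κ • (w - p)), by module⟩
  rw [show p + e - κ • (p - w) - (p + κ • (w - p)) = e by module] at hqp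
  set q := p + e - κ • (p - w)
  have hdiff : q - p = e - κ • (p - w) := by simp only [q]; abel
  have hnorm : ‖q - p‖ ≤ 3 * κ :=
    calc ‖q - p‖ ≤ ‖e‖ + κ * ‖p - w‖ := by
          simpa only [hdiff, norm_smul, Real.norm_of_nonneg hκ.le] using norm_sub_le e (κ • (p - w))
      _ ≤ κ ^ 2 + κ * 2 := by gcongr
      _ ≤ 3 * κ := by nlinarith
  have hdirection : pairing (g q) (p - w) ≤ pairing (g p) (p - w) + 2 * G * κ := by
    have hmono := hp.pairing_le hq
    simp only [hdiff, pairing_sub (g p) e, pairing_sub (g q) e, pairing_smul] at hmono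
    have hep := (abs_le.1 (abs_pairing_le hgp e)).1
    have heq := (abs_le.1 (abs_pairing_le hgq e)).2
    have hGe : G * ‖e‖ ≤ G * κ ^ 2 := by gcongr
    refine le_of_mul_le_mul_left ?_ hκ
    linarith
  have hmove : pairing (g q) (q - p) ≤ G * (3 * κ) :=
    (abs_le.1 (abs_pairing_le hgq _)).2.trans (by gcongr)
  refine ⟨hnorm, ?_⟩
  simp only [linearizedRegret]
  rw [← sub_add_sub_cancel q p w, pairing_add]
  linarith

theorem surrogateGap_le_add {c : ℝ} (hc : 0 ≤ c) (hcG : c * (2 * G) ≤ 1 / 4) (hκ : 0 < κ)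
    (hκ1 : κ ≤ 1) (hsub : ∀ θ ∈ unitBall d, IsSubgradientAt f θ (g θ))
    (hG : ∀ θ ∈ unitBall d, ‖g θ‖ ≤ G) (hp : p ∈ unitBall d) (hq : q ∈ unitBall d)
    (hw : w ∈ unitBall d) (hqp : ‖q - (p + κ • (w - p))‖ ≤ κ ^ 2) :
    surrogateGap c f g p w ≤ surrogateGap c f g q w + 13 * G * κ := by
  have hG0 : 0 ≤ G := (norm_nonneg _).trans (hG p hp)
  have hsmall : ∀ u ∈ unitBall d, |c * linearizedRegret g u w| ≤ 1 / 4 := fun u hu => by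
    rw [abs_mul, abs_of_nonneg hc]
    exact (mul_le_mul_of_nonneg_left (abs_linearizedRegret_le (hG u hu) hu hw) hc).trans hcG
  obtain ⟨hnorm, hregret⟩ := linearizedRegret_le_add (hsub p hp) (hsub q hq) (hG p hp) (hG q hq)
    hκ hκ1 (norm_sub_le_two_of_mem_unitBall hp hw) hqp
  have hloss : f p - f q ≤ G * (3 * κ) :=
    ((hsub p hp).sub_le_mul_norm (hG p hp) q).trans (by rw [norm_sub_rev]; gcongr)
  have hsurrogate := sub_mul_sq_le_add (hsmall p hp) (hsmall q hq) (by positivity) hregret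
  simp only [surrogateGap]
  linarith

end Subgradient

/-- A random loss `L` of one round, with a subgradient oracle `g` on the unit ball that is bounded
by `G` in `ℓ_∞`-norm. Measurability of `g` is kept separate, since it depends on a filtration. -/
structure IsLipschitzLoss {Ω : Type*} {m0 : MeasurableSpace Ω} (P : Measure Ω) {d : ℕ}
    (L : Ω → Param d → ℝ) (g : Ω → Param d → Fin d → ℝ) (G : ℝ) : Prop where
  integrable : ∀ θ ∈ unitBall d, Integrable (fun ω => L ω θ) P
  subgradient : ∀ᵐ ω ∂P, ∀ θ ∈ unitBall d, IsSubgradientAt (L ω) θ (g ω θ)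
  norm_grad_le : ∀ᵐ ω ∂P, ∀ θ ∈ unitBall d, ‖g ω θ‖ ≤ G

/-- At all deterministic points of the unit ball, the conditional expectation of the surrogate gap
is at most `δ`. -/
def SurrogateBound {Ω : Type*} {_ : MeasurableSpace Ω} (P : Measure Ω) (m : MeasurableSpace Ω)
    {d : ℕ} (L : Ω → Param d → ℝ) (g : Ω → Param d → Fin d → ℝ) (c δ : ℝ) : Prop :=
  ∀ u ∈ unitBall d, ∀ w ∈ unitBall d,
    ∀ᵐ ω ∂P, (P[fun ω' => surrogateGap c (L ω') (g ω') u w | m]) ω ≤ δ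

section OneRound

variable {Ω : Type*} {m m0 : MeasurableSpace Ω} {P : Measure Ω} {d : ℕ}
  {L : Ω → Param d → ℝ} {g : Ω → Param d → Fin d → ℝ} {G c δ : ℝ} {p : Ω → Param d}
  {w : Param d}

theorem exists_simpleFunc_unitBall (d : ℕ) {ε : ℝ} (hε : 0 < ε) :
    ∃ φ : SimpleFunc (Param d) (Param d), (∀ u, φ u ∈ unitBall d) ∧
      ∀ u ∈ unitBall d, ‖φ u - u‖ ≤ ε := by
  simpa only [dist_eq_norm, unitBall] using exists_simpleFunc_dist_le
    (isCompact_closedBall (0 : Param d) 1) (Metric.nonempty_closedBall.2 zero_le_one) hε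

namespace IsLipschitzLoss

theorem ae_abs_sub_le (h : IsLipschitzLoss P L g G) : ∀ᵐ ω ∂P, ∀ u ∈ unitBall d,
    ∀ v ∈ unitBall d, |L ω u - L ω v| ≤ G * ‖u - v‖ := by
  filter_upwards [h.subgradient, h.norm_grad_le] with ω hsub hG u hu v hv
  have hvu := (hsub v hv).sub_le_mul_norm (hG v hv) u
  rw [norm_sub_rev] at hvu
  exact abs_le.2 ⟨by linarith, (hsub u hu).sub_le_mul_norm (hG u hu) v⟩

theorem ae_abs_linearizedRegret_le (h : IsLipschitzLoss P L g G) : ∀ᵐ ω ∂P, ∀ u ∈ unitBall d,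
    ∀ v ∈ unitBall d, |linearizedRegret (g ω) u v| ≤ 2 * G := by
  filter_upwards [h.norm_grad_le] with ω hG u hu v hv
  exact abs_linearizedRegret_le (hG u hu) hu hv

variable [IsFiniteMeasure P]

theorem integrable_comp (h : IsLipschitzLoss P L g G) (hp : Measurable p)
    (hpb : ∀ ω, p ω ∈ unitBall d) : Integrable (fun ω => L ω (p ω)) P := by
  choose φ hφ hφε using fun n : ℕ => exists_simpleFunc_unitBall d (Nat.one_div_pos_of_nat (n := n))
  have hint (n : ℕ) : Integrable (fun ω => L ω (φ n (p ω))) P :=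
    integrable_comp_of_mem_finset ((φ n).measurable.comp hp)
      (fun ω => (φ n).mem_range_self (p ω)) fun u hu => by
        obtain ⟨v, rfl⟩ := SimpleFunc.mem_range.1 hu
        exact h.integrable _ (hφ n v)
  have hclose : ∀ᵐ ω ∂P, ∀ n : ℕ, ‖L ω (φ n (p ω)) - L ω (p ω)‖ ≤ G * (1 / ((n : ℝ) + 1)) := by
    filter_upwards [h.ae_abs_sub_le, h.norm_grad_le] with ω hL hG n
    have hG0 : 0 ≤ G := (norm_nonneg _).trans (hG _ (hpb ω))
    exact (hL _ (hφ n _) _ (hpb ω)).trans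
      (mul_le_mul_of_nonneg_left (hφε n _ (hpb ω)) hG0)
  have hmeas : AEStronglyMeasurable (fun ω => L ω (p ω)) P := by
    refine aestronglyMeasurable_of_tendsto_ae atTop (fun n => (hint n).aestronglyMeasurable) ?_
    filter_upwards [hclose] with ω hω
    rw [tendsto_iff_norm_sub_tendsto_zero]
    refine squeeze_zero (fun n => norm_nonneg _) hω ?_
    simpa using tendsto_one_div_add_atTop_nhds_zero_nat.const_mul G
  have hdiff : Integrable (fun ω => L ω (φ 0 (p ω)) - L ω (p ω)) P :=
    .of_bound ((hint 0).aestronglyMeasurable.sub hmeas) G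
      (hclose.mono fun ω hω => by simpa using hω 0)
  exact ((hint 0).sub hdiff).congr (.of_forall fun ω => sub_sub_cancel _ _)

theorem integrable_comp_linearizedRegret (h : IsLipschitzLoss P L g G)
    (hg : Measurable fun q : Ω × Param d => g q.1 q.2) (hp : Measurable p)
    (hpb : ∀ ω, p ω ∈ unitBall d) (hw : w ∈ unitBall d) {F : ℝ → ℝ} (hF : Measurable F) {B : ℝ}
    (hFB : ∀ r, |r| ≤ 2 * G → |F r| ≤ B) :
    Integrable (fun ω => F (linearizedRegret (g ω) (p ω) w)) P := by
  refine .of_bound (hF.comp (measurable_linearizedRegret hg hp w)).aestronglyMeasurable B ?_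
  filter_upwards [h.ae_abs_linearizedRegret_le] with ω hω
  exact hFB _ (hω _ (hpb ω) w hw)

theorem integrable_surrogate (h : IsLipschitzLoss P L g G)
    (hg : Measurable fun q : Ω × Param d => g q.1 q.2) (hp : Measurable p)
    (hpb : ∀ ω, p ω ∈ unitBall d) (hw : w ∈ unitBall d) (c : ℝ) :
    Integrable (fun ω => linearizedRegret (g ω) (p ω) w -
      c * linearizedRegret (g ω) (p ω) w ^ 2) P := by
  refine h.integrable_comp_linearizedRegret hg hp hpb hw (F := fun r => r - c * r ^ 2)
    (by fun_prop) (B := 2 * G + |c| * (2 * G) ^ 2) fun r hr => (abs_sub _ _).trans ?_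
  rw [abs_mul, abs_pow]
  gcongr

theorem integrable_surrogateGap (h : IsLipschitzLoss P L g G)
    (hg : Measurable fun q : Ω × Param d => g q.1 q.2) (hp : Measurable p)
    (hpb : ∀ ω, p ω ∈ unitBall d) (hw : w ∈ unitBall d) (c : ℝ) :
    Integrable (fun ω => surrogateGap c (L ω) (g ω) (p ω) w) P :=
  ((h.integrable_comp hp hpb).sub (h.integrable w hw)).sub
    (h.integrable_surrogate hg hp hpb hw c)

theorem condExp_surrogateGap_le_add (h : IsLipschitzLoss P L g G)
    (hg : Measurable fun q : Ω × Param d => g q.1 q.2) (hm : m ≤ m0)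
    (hδ : SurrogateBound P m L g c δ) (hc : 0 ≤ c) (hcG : c * (2 * G) ≤ 1 / 4)
    (hp : Measurable[m] p) (hpb : ∀ ω, p ω ∈ unitBall d) (hw : w ∈ unitBall d) {κ : ℝ}
    (hκ : 0 < κ) (hκ1 : κ ≤ 1) :
    ∀ᵐ ω ∂P, (P[fun ω' => surrogateGap c (L ω') (g ω') (p ω') w | m]) ω ≤ δ + 13 * G * κ := by
  obtain ⟨φ, hφ, hφε⟩ := exists_simpleFunc_unitBall d (pow_pos hκ 2)
  let q : Ω → Param d := fun ω => p ω + κ • (w - p ω)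
  have hq : Measurable[m] q :=
    (show Measurable fun v : Param d => v + κ • (w - v) by fun_prop).comp hp
  have hqb (ω : Ω) : q ω ∈ unitBall d :=
    (convex_unitBall d).add_smul_sub_mem (hpb ω) hw ⟨hκ.le, hκ1⟩
  have hφq : Measurable[m] fun ω => φ (q ω) := φ.measurable.comp hq
  have hint := h.integrable_surrogateGap hg (hφq.mono hm le_rfl) (fun ω => hφ (q ω)) hw c
  have hfinite := condExp_comp_of_mem_finset hm hφq (fun ω => φ.mem_range_self (q ω))
    (f := fun ω u => surrogateGap c (L ω) (g ω) u w) fun u hu => by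
      obtain ⟨v, rfl⟩ := SimpleFunc.mem_range.1 hu
      exact h.integrable_surrogateGap hg measurable_const (fun _ => hφ v) hw c
  have hvalues : ∀ᵐ ω ∂P, ∀ u ∈ φ.range,
      (P[fun ω' => surrogateGap c (L ω') (g ω') u w | m]) ω ≤ δ :=
    (Finset.eventually_all _).2 fun u hu => by
      obtain ⟨v, rfl⟩ := SimpleFunc.mem_range.1 hu
      exact hδ _ (hφ v) w hw
  have hmono := condExp_mono (m := m)
    (h.integrable_surrogateGap hg (hp.mono hm le_rfl) hpb hw c)
    (hint.add (integrable_const (13 * G * κ))) (by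
      filter_upwards [h.subgradient, h.norm_grad_le] with ω hsub hG
      exact surrogateGap_le_add hc hcG hκ hκ1 hsub hG (hpb ω) (hφ _) hw (hφε _ (hqb ω)))
  filter_upwards [hfinite, hvalues, hmono, condExp_add hint (integrable_const (13 * G * κ)) m]
    with ω hfinite hvalues hmono hadd
  rw [hadd, Pi.add_apply, condExp_const hm, hfinite] at hmono
  exact hmono.trans (by gcongr; exact hvalues _ (φ.mem_range_self _))

theorem condExp_surrogateGap_le (h : IsLipschitzLoss P L g G)
    (hg : Measurable fun q : Ω × Param d => g q.1 q.2) (hm : m ≤ m0)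
    (hδ : SurrogateBound P m L g c δ) (hc : 0 ≤ c) (hcG : c * (2 * G) ≤ 1 / 4)
    (hp : Measurable[m] p) (hpb : ∀ ω, p ω ∈ unitBall d) (hw : w ∈ unitBall d) :
    ∀ᵐ ω ∂P, (P[fun ω' => surrogateGap c (L ω') (g ω') (p ω') w | m]) ω ≤ δ := by
  have hκ (n : ℕ) := h.condExp_surrogateGap_le_add (κ := 1 / ((n : ℝ) + 1)) hg hm hδ hc hcG hp hpb
    hw Nat.one_div_pos_of_nat (by simpa using Nat.one_div_le_one_div (α := ℝ) n.zero_le)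
  filter_upwards [ae_all_iff.2 hκ] with ω hω
  have hlim : Tendsto (fun n : ℕ => δ + 13 * G * (1 / ((n : ℝ) + 1))) atTop (nhds δ) := by
    simpa using (tendsto_one_div_add_atTop_nhds_zero_nat.const_mul (13 * G)).const_add δ
  exact ge_of_tendsto' hlim hω

end IsLipschitzLoss

end OneRound

/-! ### Surrogate bounds and the risk -/

section SurrogateBound

variable {Ω : Type*} {m m0 : MeasurableSpace Ω} {P : Measure Ω} {d : ℕ} {L : Ω → Param d → ℝ}
  {g : Ω → Param d → Fin d → ℝ} {G c δ : ℝ}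

theorem SurrogateBound.mono (h : SurrogateBound P m L g c δ) {δ' : ℝ} (hδ : δ ≤ δ') :
    SurrogateBound P m L g c δ' :=
  fun u hu w hw => (h u hu w hw).mono fun _ hω => hω.trans hδ

variable [IsFiniteMeasure P]

theorem IsLipschitzLoss.surrogateBound (h : IsLipschitzLoss P L g G)
    (hg : Measurable fun q : Ω × Param d => g q.1 q.2) (hm : m ≤ m0) (hc : 0 ≤ c) :
    SurrogateBound P m L g c (4 * c * G ^ 2) := by
  intro u hu w hw
  refine condExp_le_const hm
    (h.integrable_surrogateGap hg measurable_const (fun _ => hu) hw c) ?_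
  filter_upwards [h.subgradient, h.ae_abs_linearizedRegret_le] with ω hsub hregret
  have hlinear : L ω u - L ω w ≤ linearizedRegret (g ω) u w := (hsub u hu).sub_le w
  have hsq : c * linearizedRegret (g ω) u w ^ 2 ≤ c * (2 * G) ^ 2 := by
    gcongr ?_ * ?_
    exact sq_le_sq' (abs_le.1 (hregret u hu w hw)).1 (abs_le.1 (hregret u hu w hw)).2
  simp only [surrogateGap]
  linarith

theorem condExp_le_of_le_sub_add (hm : m ≤ m0) {S F Y Z : Ω → ℝ} {ρ : ℝ} (hS : Integrable S P)
    (hF : Integrable F P) (hY : Integrable Y P) (hZ : Integrable Z P)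
    (hle : ∀ᵐ ω ∂P, S ω ≤ F ω - Y ω + Z ω + ρ)
    (hcond : ∀ᵐ ω ∂P, (P[F | m]) ω ≤ (P[Y | m]) ω - (P[Z | m]) ω) :
    ∀ᵐ ω ∂P, (P[S | m]) ω ≤ ρ := by
  have hmono := condExp_mono (m := m) hS (((hF.sub hY).add hZ).add (integrable_const ρ)) hle
  filter_upwards [hmono, condExp_add ((hF.sub hY).add hZ) (integrable_const ρ) m,
    condExp_add (hF.sub hY) hZ m, condExp_sub hF hY m, hcond] with ω hmono hρ hadd hsub hcond
  rw [hρ, Pi.add_apply, hadd, Pi.add_apply, hsub, Pi.sub_apply, condExp_const hm] at hmono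
  linarith

/- With `y = r²`, Young's inequality gives `c y ≤ (α y) ^ (1 / β) + ρ`; when `β = 0` the power
vanishes and `α y ≤ 1` is used instead. -/
theorem WeakExpConcave.surrogateBound {ℱ : Filtration ℕ m0} {ℓ : ℕ → Ω → Param d → ℝ}
    {grad : ℕ → Ω → Param d → Fin d → ℝ} {α β ρ : ℝ} (h : WeakExpConcave P ℱ ℓ grad α β)
    (hα : 0 ≤ α) (hβ : 0 ≤ β) (hβ1 : β ≤ 1) (hρ : 0 ≤ ρ) (hcρ : c ≤ α * ρ ^ (1 - β)) {t : ℕ}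
    (hL : IsLipschitzLoss P (ℓ (t + 1)) (grad (t + 1)) G)
    (hg : Measurable fun q : Ω × Param d => grad (t + 1) q.1 q.2) :
    SurrogateBound P (ℱ t) (ℓ (t + 1)) (grad (t + 1)) c ρ := by
  intro u hu w hw
  obtain ⟨hpos, hzero⟩ := h (t + 1) t.succ_pos u hu w hw
  have hgap := hL.integrable_surrogateGap hg measurable_const (fun _ => hu) hw c
  have hloss := (hL.integrable u hu).sub (hL.integrable w hw)
  have hregret := hL.integrable_comp_linearizedRegret hg measurable_const (fun _ => hu) hw
    measurable_id fun _ hr => hr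
  have hscale (r : ℝ) : c * r ^ 2 ≤ ρ ^ (1 - β) * (α * r ^ 2) := by
    nlinarith [mul_le_mul_of_nonneg_right hcρ (sq_nonneg r)]
  rcases hβ.eq_or_lt with rfl | hβ0
  · obtain ⟨hle, hcond⟩ := hzero rfl
    refine condExp_le_of_le_sub_add (ℱ.le t) hgap hloss hregret (integrable_zero _ _ _) ?_
      (hcond.mono fun ω hω => hω.trans_eq (by rw [condExp_zero, Pi.zero_apply, sub_zero]; rfl))
    filter_upwards [hle] with ω hω
    have hsmall := mul_le_mul_of_nonneg_left hω hρ
    have hquad := hscale (linearizedRegret (grad (t + 1) ω) u w)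
    rw [sub_zero, Real.rpow_one] at hquad
    simp only [surrogateGap, linearizedRegret, Pi.sub_apply, Pi.zero_apply, id] at hsmall hquad ⊢
    linarith
  · have hpower := hL.integrable_comp_linearizedRegret hg measurable_const (fun _ => hu) hw
      (F := fun r => (α * r ^ 2) ^ (1 / β)) (by fun_prop) (B := (α * (2 * G) ^ 2) ^ (1 / β))
      fun r hr => by
        rw [abs_of_nonneg (by positivity)]
        gcongr ?_ ^ _
        exact mul_le_mul_of_nonneg_left (sq_le_sq' (abs_le.1 hr).1 (abs_le.1 hr).2) hα
    refine condExp_le_of_le_sub_add (ℱ.le t) hgap hloss hregret hpower (.of_forall fun ω => ?_)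
      (hpos hβ0)
    have hyoung := rpow_one_sub_mul_le (z := α * linearizedRegret (grad (t + 1) ω) u w ^ 2)
      (by positivity) hρ hβ0 hβ1
    have hquad := hscale (linearizedRegret (grad (t + 1) ω) u w)
    simp only [surrogateGap, Pi.sub_apply, id]
    linarith

end SurrogateBound

section Risk

variable {Ω : Type*} {m m0 : MeasurableSpace Ω} {P : Measure Ω} {ℱ : Filtration ℕ m0} {d : ℕ}
  {ℓ : ℕ → Ω → Param d → ℝ} {grad : ℕ → Ω → Param d → Fin d → ℝ} {G : ℝ}
  {pred : ℕ → Ω → Param d} {T : ℕ} {θ : Param d}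

theorem averageRisk_le_sum [IsFiniteMeasure P]
    (hL : ∀ t, IsLipschitzLoss P (ℓ (t + 1)) (grad (t + 1)) G)
    (hpred : ∀ t, Measurable[ℱ t] (pred t)) (hball : ∀ t ω, pred t ω ∈ unitBall d)
    (hθ : θ ∈ unitBall d) {b : ℕ → Ω → ℝ}
    (hb : ∀ t, ∀ᵐ ω ∂P,
      (P[fun ω' => ℓ (t + 1) ω' (pred t ω') - ℓ (t + 1) ω' θ | ℱ t]) ω ≤ b t ω) (T : ℕ) :
    ∀ᵐ ω ∂P, averageRisk P ℱ ℓ pred T θ ω ≤ 1 / (T : ℝ) * ∑ t ∈ Finset.range T, b t ω := by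
  have hsub (t : ℕ) : P[fun ω => ℓ (t + 1) ω (pred t ω) - ℓ (t + 1) ω θ | ℱ t] =ᵐ[P] _ :=
    condExp_sub ((hL t).integrable_comp ((hpred t).mono (ℱ.le t) le_rfl) (hball t))
      ((hL t).integrable θ hθ) (ℱ t)
  have hshift (f : ℕ → ℝ) : ∑ t ∈ Finset.Icc 1 T, f t = ∑ t ∈ Finset.range T, f (t + 1) := by
    rw [Finset.range_eq_Ico, Finset.sum_Ico_add' f 0 T 1, Finset.Ico_add_one_right_eq_Icc]
  filter_upwards [ae_all_iff.2 hsub, ae_all_iff.2 hb] with ω hsub hb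
  rw [averageRisk, hshift, hshift, ← mul_sub, ← Finset.sum_sub_distrib]
  gcongr with t _
  exact (hsub t).symm.trans_le (hb t)

theorem averageRisk_le_mul [IsProbabilityMeasure P]
    (hL : ∀ t, IsLipschitzLoss P (ℓ (t + 1)) (grad (t + 1)) G)
    (hpred : ∀ t, Measurable[ℱ t] (pred t)) (hball : ∀ t ω, pred t ω ∈ unitBall d)
    (hθ : θ ∈ unitBall d) {D : ℝ} (hD : ∀ t ω, ‖pred t ω - θ‖ ≤ D) (hT : T ≠ 0) :
    ∀ᵐ ω ∂P, averageRisk P ℱ ℓ pred T θ ω ≤ G * D := by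
  have hround (t : ℕ) : ∀ᵐ ω ∂P,
      (P[fun ω' => ℓ (t + 1) ω' (pred t ω') - ℓ (t + 1) ω' θ | ℱ t]) ω ≤ G * D := by
    refine condExp_le_const (ℱ.le t) (((hL t).integrable_comp
      ((hpred t).mono (ℱ.le t) le_rfl) (hball t)).sub ((hL t).integrable θ hθ)) ?_
    filter_upwards [(hL t).ae_abs_sub_le, (hL t).norm_grad_le] with ω hL hG
    have hG0 : 0 ≤ G := (norm_nonneg _).trans (hG θ hθ)
    exact (abs_le.1 (hL _ (hball t ω) θ hθ)).2.trans (by gcongr; exact hD t ω)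
  refine (averageRisk_le_sum hL hpred hball hθ hround T).mono fun ω hω => hω.trans_eq ?_
  rw [Finset.sum_const, Finset.card_range, nsmul_eq_mul]
  field_simp

theorem condExp_loss_sub_le_add [IsFiniteMeasure P] (hm : m ≤ m0)
    {L : Ω → Param d → ℝ} {g : Ω → Param d → Fin d → ℝ} (h : IsLipschitzLoss P L g G)
    (hg : Measurable fun q : Ω × Param d => g q.1 q.2) {c δ : ℝ}
    (hδ : SurrogateBound P m L g c δ) (hc : 0 ≤ c) (hcG : c * (2 * G) ≤ 1 / 4) {p : Ω → Param d}
    (hp : Measurable[m] p) (hpb : ∀ ω, p ω ∈ unitBall d) {v : Param d} (hv : v ∈ unitBall d)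
    (hθ : θ ∈ unitBall d) {ε : ℝ} (hvθ : ‖v - θ‖ ≤ ε) :
    ∀ᵐ ω ∂P, (P[fun ω' => L ω' (p ω') - L ω' θ | m]) ω ≤
      (P[fun ω' => linearizedRegret (g ω') (p ω') v -
        c * linearizedRegret (g ω') (p ω') v ^ 2 | m]) ω + δ + G * ε := by
  have hp0 : Measurable p := hp.mono hm le_rfl
  have hgap := h.integrable_surrogateGap hg hp0 hpb hv c
  have hsurrogate := h.integrable_surrogate hg hp0 hpb hv c
  have hmono := condExp_mono (m := m) ((h.integrable_comp hp0 hpb).sub (h.integrable θ hθ))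
    ((hgap.add hsurrogate).add (integrable_const (G * ε))) (by
      filter_upwards [h.ae_abs_sub_le, h.norm_grad_le] with ω hL hG
      have hG0 : 0 ≤ G := (norm_nonneg _).trans (hG θ hθ)
      have hvε : L ω v - L ω θ ≤ G * ε :=
        (abs_le.1 (hL v hv θ hθ)).2.trans (by gcongr)
      simp only [Pi.sub_apply, Pi.add_apply, surrogateGap]
      linarith)
  filter_upwards [hmono, condExp_add (hgap.add hsurrogate) (integrable_const (G * ε)) m,
    condExp_add hgap hsurrogate m, h.condExp_surrogateGap_le hg hm hδ hc hcG hp hpb hv]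
    with ω hmono hadd hadd' hδ
  rw [hadd, Pi.add_apply, hadd', Pi.add_apply, condExp_const hm] at hmono
  exact hmono.trans (by linarith)

end Risk

section SquintRisk

variable {Ω : Type*} {m0 : MeasurableSpace Ω} {P : Measure Ω} {ℱ : Filtration ℕ m0} {d : ℕ}
  {ℓ : ℕ → Ω → Param d → ℝ} {grad : ℕ → Ω → Param d → Fin d → ℝ} {G E : ℝ}
  {Θ₀ : Finset (Param d)} {prior : Param d → ℝ} {N : ℕ}

theorem uniformPrior_pos (hΘ : Θ₀.Nonempty) (θ : Param d) : 0 < uniformPrior Θ₀ θ :=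
  one_div_pos.2 (by exact_mod_cast hΘ.card_pos)

theorem squint_uniformPrior_mem (hΘ : Θ₀.Nonempty) (hΘb : (Θ₀ : Set (Param d)) ⊆ unitBall d)
    (hE : 0 < E) (hN : 1 ≤ N) (g : ℕ → Param d → Fin d → ℝ) (t : ℕ) :
    squint Θ₀ (uniformPrior Θ₀) E N g t ∈ unitBall d :=
  aggregate_mem (convex_unitBall d) hΘ hΘb (fun θ _ => uniformPrior_pos hΘ θ) hE hN _

theorem learningRate_mul_le (hE : 0 < E) {i : ℕ} (hi : 3 ≤ i) :
    learningRate E i * (3 / 2 * E) ≤ 1 / 12 := by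
  have hexp : 18 ≤ Real.exp (3 : ℕ) :=
    calc (18 : ℝ) ≤ 2.7 ^ 3 := by norm_num
      _ ≤ Real.exp 1 ^ 3 := by gcongr; linarith [Real.exp_one_gt_d9]
      _ = Real.exp (3 : ℕ) := by rw [← Real.exp_nat_mul, mul_one]
  have hanti := learningRate_anti hE hi
  have hηE : 0 < learningRate E 3 * E := mul_pos (learningRate_pos hE 3) hE
  nlinarith [learningRate_mul_exp hE 3, mul_le_mul_of_nonneg_left hexp hηE.le]

theorem ae_abs_instantRegret_le (hL : ∀ t, IsLipschitzLoss P (ℓ (t + 1)) (grad (t + 1)) G)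
    (hΘ : Θ₀.Nonempty) (hΘb : (Θ₀ : Set (Param d)) ⊆ unitBall d) (hp : ∀ θ ∈ Θ₀, 0 < prior θ)
    (hE : 0 < E) (hN : 1 ≤ N) : ∀ᵐ ω ∂P, ∀ t, ∀ θ ∈ Θ₀,
      |instantRegret Θ₀ prior E N (fun s => grad s ω) t θ| ≤ 2 * G := by
  filter_upwards [ae_all_iff.2 fun t => (hL t).ae_abs_linearizedRegret_le] with ω hω t θ hθ
  exact hω t _ (aggregate_mem (convex_unitBall d) hΘ hΘb hp hE hN _) θ (hΘb hθ)

variable [IsProbabilityMeasure P]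

theorem exists_event_sum_condExp_instantRegret_le
    (hL : ∀ t, IsLipschitzLoss P (ℓ (t + 1)) (grad (t + 1)) G)
    (hgrad : IsAdaptedOracle ℱ grad)
    (hΘ : Θ₀.Nonempty) (hΘb : (Θ₀ : Set (Param d)) ⊆ unitBall d) (hp : ∀ θ ∈ Θ₀, 0 < prior θ)
    (hE : 0 < E) (hGE : 2 * G ≤ 3 / 2 * E) {i : ℕ} (hi : 3 ≤ i) (hiN : i ≤ N) (T : ℕ) (x : ℝ) :
    ∃ A, MeasurableSet A ∧ 1 - Real.exp (-x) ≤ P.real A ∧ ∀ᵐ ω ∂P, ω ∈ A → ∀ θ ∈ Θ₀,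
      ∑ t ∈ Finset.range T, (P[fun ω' =>
        learningRate E i * instantRegret Θ₀ prior E N (fun s => grad s ω') t θ -
          3 * (learningRate E i * instantRegret Θ₀ prior E N (fun s => grad s ω') t θ) ^ 2 | ℱ t])
            ω ≤ Real.log (N * (∑ ϑ ∈ Θ₀, prior ϑ) / prior θ) + Real.log Θ₀.card + x := by
  have hη := learningRate_pos hE i
  have hregret := ae_abs_instantRegret_le hL hΘ hΘb hp hE (show 1 ≤ N by omega)
  obtain ⟨A, hA, hPA, hAle⟩ := exists_event_sum_condExp_le (ℱ := ℱ) (P := P) Θ₀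
    (X := fun θ t ω => learningRate E i * instantRegret Θ₀ prior E N (fun s => grad s ω) t θ)
    (fun θ _ t => (measurable_instantRegret hgrad t θ).const_mul _)
    (fun θ hθ t => by
      filter_upwards [hregret] with ω hω
      rw [abs_mul, abs_of_pos hη]
      linarith [mul_le_mul_of_nonneg_left ((hω t θ hθ).trans hGE) hη.le,
        learningRate_mul_le hE hi]) T x
  refine ⟨A, hA, hPA, ?_⟩
  filter_upwards [hregret] with ω hω hωA θ hθ
  have hsum := sum_instantRegret_sub_sq_le hp hE (fun s => grad s ω) T
    (fun t _ ϑ hϑ => by linarith [(abs_le.1 (hω t ϑ hϑ)).1]) hθ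
    (Finset.mem_Icc.2 ⟨by omega, hiN⟩)
  linarith [hAle ω hωA θ hθ]

theorem condExp_squint_sub_le (hL : ∀ t, IsLipschitzLoss P (ℓ (t + 1)) (grad (t + 1)) G)
    (hgrad : IsAdaptedOracle ℱ grad)
    (hE : 0 < E) (hGE : 2 * G ≤ 3 / 2 * E) {i : ℕ} (hi : 3 ≤ i) {δ : ℝ} {t : ℕ}
    (hδ : SurrogateBound P (ℱ t) (ℓ (t + 1)) (grad (t + 1)) (3 * learningRate E i) δ)
    (hball : ∀ ω, squint Θ₀ prior E N (fun s => grad s ω) t ∈ unitBall d)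
    {v θ : Param d} (hv : v ∈ unitBall d) (hθ : θ ∈ unitBall d) {ε : ℝ} (hvθ : ‖v - θ‖ ≤ ε) :
    ∀ᵐ ω ∂P, (P[fun ω' => ℓ (t + 1) ω' (squint Θ₀ prior E N (fun s => grad s ω') t) -
        ℓ (t + 1) ω' θ | ℱ t]) ω ≤
      δ + G * ε + (learningRate E i)⁻¹ * (P[fun ω' =>
        learningRate E i * instantRegret Θ₀ prior E N (fun s => grad s ω') t v -
          3 * (learningRate E i * instantRegret Θ₀ prior E N (fun s => grad s ω') t v) ^ 2 |
            ℱ t]) ω := by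
  have hη := learningRate_pos hE i
  have hg : Measurable fun q : Ω × Param d => grad (t + 1) q.1 q.2 :=
    measurable_of_prod_le (ℱ.le _) (hgrad t)
  have hcG : 3 * learningRate E i * (2 * G) ≤ 1 / 4 := by
    linarith [mul_le_mul_of_nonneg_left hGE hη.le, learningRate_mul_le hE hi]
  have hscale : (fun ω => learningRate E i * instantRegret Θ₀ prior E N (fun s => grad s ω) t v -
      3 * (learningRate E i * instantRegret Θ₀ prior E N (fun s => grad s ω) t v) ^ 2) =
      learningRate E i • fun ω => instantRegret Θ₀ prior E N (fun s => grad s ω) t v -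
        3 * learningRate E i * instantRegret Θ₀ prior E N (fun s => grad s ω) t v ^ 2 := by
    ext ω
    simp only [Pi.smul_apply, smul_eq_mul]
    ring
  rw [hscale]
  filter_upwards [condExp_loss_sub_le_add (ℱ.le t) (hL t) hg hδ (by positivity) hcG
    (measurable_squint hgrad t) hball hv hθ hvθ,
    condExp_smul (learningRate E i) (μ := P) (m := ℱ t) fun ω =>
      instantRegret Θ₀ prior E N (fun s => grad s ω) t v -
        3 * learningRate E i * instantRegret Θ₀ prior E N (fun s => grad s ω) t v ^ 2]
    with ω hω hsmul
  rw [hsmul, Pi.smul_apply, smul_eq_mul, inv_mul_cancel_left₀ hη.ne']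
  simp only [instantRegret]
  linarith

theorem exists_event_averageRisk_le (hL : ∀ t, IsLipschitzLoss P (ℓ (t + 1)) (grad (t + 1)) G)
    (hgrad : IsAdaptedOracle ℱ grad)
    {ε : NNReal} (hΘb : (Θ₀ : Set (Param d)) ⊆ unitBall d)
    (hcover : Metric.IsCover ε (unitBall d) (Θ₀ : Set (Param d))) (hE : 0 < E)
    (hGE : 2 * G ≤ 3 / 2 * E) {i : ℕ} (hi : 3 ≤ i) (hiN : i ≤ N) {δ : ℝ}
    (hδ : ∀ t, SurrogateBound P (ℱ t) (ℓ (t + 1)) (grad (t + 1)) (3 * learningRate E i) δ)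
    {T : ℕ} (hT : T ≠ 0) (x : ℝ) :
    ∃ A, MeasurableSet A ∧ 1 - Real.exp (-x) ≤ P.real A ∧ ∀ θ ∈ unitBall d,
      ∀ᵐ ω ∂P, ω ∈ A → averageRisk P ℱ ℓ
        (fun t ω' => squint Θ₀ (uniformPrior Θ₀) E N (fun s => grad s ω') t) T θ ω ≤
        δ + G * ε + (Real.log (N * Θ₀.card) + Real.log Θ₀.card + x) /
          (learningRate E i * T) := by
  have hη := learningRate_pos hE i
  have hΘ : Θ₀.Nonempty := by
    simpa using hcover.nonempty (Metric.nonempty_closedBall.2 zero_le_one)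
  have hball := squint_uniformPrior_mem (N := N) hΘ hΘb hE (by omega)
  obtain ⟨A, hA, hPA, hsum⟩ := exists_event_sum_condExp_instantRegret_le hL hgrad hΘ hΘb
    (fun θ _ => uniformPrior_pos hΘ θ) hE hGE hi hiN T x
  refine ⟨A, hA, hPA, fun θ hθ => ?_⟩
  obtain ⟨v, hv, hθv⟩ :=
    Set.mem_iUnion₂.1 (Metric.isCover_iff_subset_iUnion_closedBall.1 hcover hθ)
  have hround (t : ℕ) := condExp_squint_sub_le hL hgrad hE hGE hi (hδ t) (fun ω => hball _ t)
    (hΘb hv) hθ (mem_closedBall_iff_norm'.1 hθv)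
  filter_upwards [hsum, averageRisk_le_sum hL (measurable_squint hgrad) (fun t ω => hball _ t) hθ
    hround T] with ω hsum hrisk hω
  have hregret := hsum hω v hv
  have hprior : N * (∑ ϑ ∈ Θ₀, uniformPrior Θ₀ ϑ) / uniformPrior Θ₀ v = N * Θ₀.card := by
    simp only [uniformPrior, Finset.sum_const, nsmul_eq_mul]
    field_simp
  rw [hprior] at hregret
  refine hrisk.trans ?_
  rw [Finset.sum_add_distrib, Finset.sum_const, Finset.card_range, nsmul_eq_mul, ← Finset.mul_sum]
  calc _ ≤ 1 / (T : ℝ) * (T * (δ + G * ε) + (learningRate E i)⁻¹ *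
        (Real.log (N * Θ₀.card) + Real.log Θ₀.card + x)) := by gcongr
    _ = _ := by field_simp

end SquintRisk

/-! ### Choice of the learning rate -/

theorem exists_mem_Icc_near {f : ℕ → ℝ} {C : ℝ} (hf : ∀ n, f n ≤ C * f (n + 1)) (y : ℝ) {m N : ℕ}
    (hmN : m ≤ N) : ∃ i ∈ Finset.Icc m N, (i = m ∨ y ≤ C * f i) ∧ (i = N ∨ f i ≤ y) := by
  induction N, hmN using Nat.le_induction with
  | base => exact ⟨m, Finset.mem_Icc.2 ⟨le_rfl, le_rfl⟩, .inl rfl, .inl rfl⟩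
  | succ N hmN ih =>
    obtain ⟨i, hi, hlower, hupper⟩ := ih
    rw [Finset.mem_Icc] at hi
    rcases le_or_gt (f i) y with hiy | hyi
    · exact ⟨i, Finset.mem_Icc.2 ⟨hi.1, by omega⟩, hlower, .inr hiy⟩
    · obtain rfl := hupper.resolve_right hyi.not_ge
      exact ⟨i + 1, Finset.mem_Icc.2 ⟨by omega, le_rfl⟩, .inr (hyi.le.trans (hf i)), .inl rfl⟩

theorem learningRate_eq_exp_mul_succ (E : ℝ) (i : ℕ) :
    learningRate E i = Real.exp 1 * learningRate E (i + 1) := by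
  simp only [learningRate]
  rw [Nat.cast_succ, Real.exp_add]
  field_simp

theorem one_div_learningRate_three_le {E : ℝ} (hE : 0 < E) : 1 / learningRate E 3 ≤ 81 / 4 * E := by
  have hexp : Real.exp (3 : ℕ) ≤ 81 / 4 :=
    calc Real.exp (3 : ℕ) = Real.exp 1 ^ 3 := by rw [← Real.exp_nat_mul, mul_one]
      _ ≤ 2.72 ^ 3 := by gcongr; linarith [Real.exp_one_lt_d9]
      _ ≤ 81 / 4 := by norm_num
  rw [learningRate, one_div, inv_inv]
  gcongr

theorem sq_learningRate_mul_le {G : ℝ} (hG : 0 < G) {T N : ℕ}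
    (hTN : (T : ℝ) ≤ 5 * Real.exp (2 * N)) :
    learningRate (4 * G / 3) N ^ 2 * G ^ 2 * T ≤ 3 := by
  have hη : learningRate (4 * G / 3) N ^ 2 * G ^ 2 = 9 / (16 * Real.exp (2 * N)) := by
    rw [learningRate, two_mul, Real.exp_add]
    field_simp
    norm_num
  rw [hη, div_mul_eq_mul_div, div_le_iff₀ (by positivity)]
  linarith [Real.exp_pos (2 * N)]

/- The rate closest to `a / (3 T ρ)` works; if this value is below the whole grid, the smallest rate
`η_N` satisfies `η_N G² ≤ 9 ρ` since `(η_N G)² T ≤ 3`. -/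
theorem exists_learningRate_tradeoff {a ρ G : ℝ} (ha : 1 ≤ a) (hρ : 0 < ρ) (hG : 0 < G) {T N : ℕ}
    (hT : 0 < T) (hN : 3 ≤ N) (hTN : (T : ℝ) ≤ 5 * Real.exp (2 * N)) :
    ∃ i, 3 ≤ i ∧ i ≤ N ∧
      a / (learningRate (4 * G / 3) i * T) ≤ 9 * ρ + 27 * (G * a / T) ∧
      (learningRate (4 * G / 3) i ≤ a / (3 * T * ρ) ∨
        learningRate (4 * G / 3) i * G ^ 2 ≤ 9 * ρ) := by
  have hT0 : (0 : ℝ) < T := by exact_mod_cast hT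
  obtain ⟨i, hi, hlower, hupper⟩ := exists_mem_Icc_near
    (fun n => (learningRate_eq_exp_mul_succ (4 * G / 3) n).le) (a / (3 * T * ρ)) hN
  have hη : 0 < learningRate (4 * G / 3) i := learningRate_pos (by positivity) i
  have hGa : 0 < G * a / T := div_pos (mul_pos hG (by linarith)) hT0
  rw [Finset.mem_Icc] at hi
  refine ⟨i, hi.1, hi.2, ?_, ?_⟩
  · rcases hlower with rfl | hlower
    · calc a / (learningRate (4 * G / 3) 3 * T) = 1 / learningRate (4 * G / 3) 3 * (a / T) := by
            field_simp
        _ ≤ 81 / 4 * (4 * G / 3) * (a / T) := by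
            gcongr
            exact one_div_learningRate_three_le (by positivity)
        _ = 27 * (G * a / T) := by ring
        _ ≤ _ := by linarith
    · have hnear : a / (learningRate (4 * G / 3) i * T) ≤ 3 * Real.exp 1 * ρ := by
        rw [div_le_iff₀ (by positivity)] at hlower ⊢
        linarith
      nlinarith [Real.exp_one_lt_d9]
  · rcases le_or_gt (learningRate (4 * G / 3) i) (a / (3 * T * ρ)) with hle | hlt
    · exact .inl hle
    obtain rfl := hupper.resolve_right hlt.not_ge
    rw [div_lt_iff₀ (by positivity)] at hlt
    refine .inr (le_of_mul_le_mul_right ?_ (mul_pos hη hT0))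
    calc _ = learningRate (4 * G / 3) i ^ 2 * G ^ 2 * T := by ring
      _ ≤ 3 := sq_learningRate_mul_le hG hTN
      _ ≤ 9 * ρ * (learningRate (4 * G / 3) i * T) := by linarith

section Rate

variable {a α β : ℝ} {T : ℝ}

theorem rpow_one_div_mul_rpow {q : ℝ} (hq : 0 ≤ q) (hβ1 : β ≤ 1) :
    q ^ (1 / (2 - β)) * (q ^ (1 / (2 - β))) ^ (1 - β) = q := by
  rw [← Real.rpow_one_add' (Real.rpow_nonneg hq _) (by linarith), ← Real.rpow_mul hq,
    show 1 / (2 - β) * (1 + (1 - β)) = 1 by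
      have : 2 - β ≠ 0 := by linarith
      field_simp
      ring,
    Real.rpow_one]

theorem three_mul_le_mul_rpow (ha : 0 < a) (hα : 0 < α) (hβ1 : β ≤ 1) (hT : 0 < T) {η : ℝ}
    (hη : η ≤ a / (3 * T * (a / (α * T)) ^ (1 / (2 - β)))) :
    3 * η ≤ α * ((a / (α * T)) ^ (1 / (2 - β))) ^ (1 - β) := by
  have hq : 0 < a / (α * T) := by positivity
  have hmul := rpow_one_div_mul_rpow hq.le hβ1
  set ρ := (a / (α * T)) ^ (1 / (2 - β))
  have hρ : 0 < ρ := Real.rpow_pos_of_pos hq _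
  calc 3 * η ≤ 3 * (a / (3 * T * ρ)) := by gcongr
    _ = α * (a / (α * T) / ρ) := by field_simp
    _ = α * ρ ^ (1 - β) := by rw [← hmul, mul_div_cancel_left₀ _ hρ.ne']

theorem mul_rpow_le_rpow {G : ℝ} (ha : 0 < a) (hα : 0 < α) (hβ1 : β ≤ 1) (hG : 0 < G) (hT : 0 < T)
    (hαG : α * G ^ (2 - β) ≤ 1) :
    G * (a / T) ^ (1 / (2 - β)) ≤ (a / (α * T)) ^ (1 / (2 - β)) := by
  have hβ2 : 0 < 2 - β := by linarith
  calc G * (a / T) ^ (1 / (2 - β)) = (G ^ (2 - β) * (a / T)) ^ (1 / (2 - β)) := by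
        rw [Real.mul_rpow (by positivity) (by positivity), ← Real.rpow_mul hG.le,
          mul_one_div_cancel hβ2.ne', Real.rpow_one]
    _ = (α * G ^ (2 - β) * (a / (α * T))) ^ (1 / (2 - β)) := by
        congr 1
        field_simp
    _ ≤ (a / (α * T)) ^ (1 / (2 - β)) := by
        gcongr
        exact mul_le_of_le_one_left (by positivity) hαG

theorem mul_min_le_rpow {G : ℝ} (ha : 0 < a) (hα : 0 < α) (hβ1 : β ≤ 1) (hG : 0 < G) (hT : 0 < T)
    (hαG : α * G ^ (2 - β) ≤ 1) :
    G * min (a / T) 1 ≤ (a / (α * T)) ^ (1 / (2 - β)) := by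
  have hβ2 : 0 < 2 - β := by linarith
  refine le_trans ?_ (mul_rpow_le_rpow ha hα hβ1 hG hT hαG)
  gcongr
  rcases le_total (a / T) 1 with haT | haT
  · rw [min_eq_left haT]
    exact Real.self_le_rpow_of_le_one (by positivity) haT (by rw [div_le_one hβ2]; linarith)
  · rw [min_eq_right haT]
    exact Real.one_le_rpow haT (by positivity)

end Rate

section Complexity

variable {d T N : ℕ} {G x : ℝ}

theorem pos_of_exp_one_le_mul (hGT : Real.exp 1 ≤ G * T) : 0 < G :=
  pos_of_mul_pos_left ((Real.exp_pos 1).trans_le hGT) T.cast_nonneg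

theorem add_le_complexityTerm (hGT : Real.exp 1 ≤ G * T) :
    d * Real.log T + x ≤ complexityTerm d T G x := by
  have hlog : 1 ≤ Real.log (G * T) :=
    (Real.le_log_iff_exp_le ((Real.exp_pos 1).trans_le hGT)).2 hGT
  rw [complexityTerm]
  linarith [Real.log_nonneg hlog]

theorem complexityTerm_pos (hGT : Real.exp 1 ≤ G * T) (hx : 0 < x) :
    0 < complexityTerm d T G x := by
  have hlog : 0 ≤ d * Real.log T := mul_nonneg d.cast_nonneg (Real.log_natCast_nonneg T)
  linarith [add_le_complexityTerm (d := d) (x := x) hGT]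

theorem one_le_log_of_three_le (hT : 3 ≤ T) : 1 ≤ Real.log T := by
  have hT3 : (3 : ℝ) ≤ T := by exact_mod_cast hT
  exact (Real.le_log_iff_exp_le (by linarith)).2 (by linarith [Real.exp_one_lt_d9])

theorem log_gridSize_le (hT : 3 ≤ T) (hGT : Real.exp 1 ≤ G * T) (hN : 1 ≤ N)
    (hNlog : (N : ℝ) ≤ Real.log (4 * G / 3 * (T : ℝ) ^ 2)) :
    Real.log N ≤ Real.log (Real.log (G * T)) + 2 * Real.log T := by
  have hT3 : (3 : ℝ) ≤ T := by exact_mod_cast hT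
  have hT0 : (0 : ℝ) < T := by linarith
  have hGT0 : 0 < G * T := (Real.exp_pos 1).trans_le hGT
  have hu : 1 ≤ Real.log (G * T) := (Real.le_log_iff_exp_le hGT0).2 hGT
  have hv : 0 ≤ Real.log (4 / 3 * T) := Real.log_nonneg (by linarith)
  have hvT : Real.log (4 / 3 * T) ≤ 2 * Real.log T := by
    rw [Real.log_mul (by norm_num) hT0.ne', two_mul]
    gcongr
    linarith
  have hNuv : (N : ℝ) ≤ Real.log (G * T) * (1 + Real.log (4 / 3 * T)) :=
    calc (N : ℝ) ≤ Real.log (G * T * (4 / 3 * T)) := hNlog.trans_eq (by congr 1; ring)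
      _ = Real.log (G * T) + Real.log (4 / 3 * T) := Real.log_mul hGT0.ne' (by positivity)
      _ ≤ _ := by nlinarith
  calc Real.log N ≤ Real.log (Real.log (G * T) * (1 + Real.log (4 / 3 * T))) :=
        Real.log_le_log (by exact_mod_cast hN) hNuv
    _ = Real.log (Real.log (G * T)) + Real.log (1 + Real.log (4 / 3 * T)) :=
        Real.log_mul (by linarith) (by linarith)
    _ ≤ Real.log (Real.log (G * T)) + 2 * Real.log T := by
        have := Real.log_le_sub_one_of_pos (show 0 < 1 + Real.log (4 / 3 * T) by linarith)
        linarith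

theorem log_card_le_mul_log {K : ℕ} (hT : 3 ≤ T) (hK : 1 ≤ K)
    (hKle : (K : ℝ) ≤ (1 + 2 * (T : ℝ) ^ 2) ^ d) : Real.log K ≤ 4 * (d * Real.log T) := by
  have hT3 : (3 : ℝ) ≤ T := by exact_mod_cast hT
  calc Real.log K ≤ Real.log (((T : ℝ) ^ 4) ^ d) := by
        refine Real.log_le_log (by exact_mod_cast hK) (hKle.trans ?_)
        gcongr
        nlinarith [pow_le_pow_left₀ (by norm_num) hT3 2]
    _ = 4 * (d * Real.log T) := by
        rw [Real.log_pow, Real.log_pow]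
        push_cast
        ring

theorem log_experts_le_complexityTerm {K : ℕ} (hd : d ≠ 0) (hT : 3 ≤ T)
    (hGT : Real.exp 1 ≤ G * T) (hx : 0 ≤ x) (hN : 1 ≤ N)
    (hNlog : (N : ℝ) ≤ Real.log (4 * G / 3 * (T : ℝ) ^ 2)) (hK : 1 ≤ K)
    (hKle : (K : ℝ) ≤ (1 + 2 * (T : ℝ) ^ 2) ^ d) :
    Real.log (N * K) + Real.log K + x ≤ 11 * complexityTerm d T G x := by
  have hd1 : (1 : ℝ) ≤ d := by exact_mod_cast Nat.one_le_iff_ne_zero.2 hd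
  have hlogT := Real.log_natCast_nonneg T
  have hdT : Real.log T ≤ d * Real.log T := le_mul_of_one_le_left hlogT hd1
  have hloglog : 0 ≤ Real.log (Real.log (G * T)) :=
    Real.log_nonneg ((Real.le_log_iff_exp_le ((Real.exp_pos 1).trans_le hGT)).2 hGT)
  rw [Real.log_mul (by positivity) (by positivity), complexityTerm]
  have hlogN := log_gridSize_le hT hGT hN hNlog
  have hlogK := log_card_le_mul_log hT hK hKle
  linarith

theorem gridSize_bounds (hT : 1 ≤ T) (hGT : Real.exp 1 ≤ G * T)
    (hN : N = ⌊Real.log (4 * G / 3 * T)⌋₊ ∧ 1 ≤ G ^ 2 * T ∨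
      N = ⌊Real.log (4 * G / 3 * (T : ℝ) ^ 2)⌋₊) :
    1 ≤ N ∧ (N : ℝ) ≤ Real.log (4 * G / 3 * (T : ℝ) ^ 2) ∧
      (T : ℝ) ≤ 5 * Real.exp (2 * N) := by
  have hT1 : (1 : ℝ) ≤ T := by exact_mod_cast hT
  have hG := pos_of_exp_one_le_mul hGT
  have he := Real.exp_one_lt_d9
  have hlinear : 4 * G / 3 * T ≤ 4 * G / 3 * (T : ℝ) ^ 2 := by
    gcongr
    exact le_self_pow₀ hT1 two_ne_zero
  obtain ⟨y, rfl, hy, hyT, hTy⟩ : ∃ y : ℝ, N = ⌊Real.log y⌋₊ ∧ Real.exp 1 ≤ y ∧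
      y ≤ 4 * G / 3 * (T : ℝ) ^ 2 ∧ 16 / 9 * T ≤ y ^ 2 := by
    rcases hN with ⟨hN, hGT1⟩ | hN
    · refine ⟨_, hN, by linarith [Real.exp_pos 1], hlinear, ?_⟩
      nlinarith
    · refine ⟨_, hN, by linarith [Real.exp_pos 1], le_rfl, ?_⟩
      have hTle : 4 / 3 * T ≤ 4 * G / 3 * (T : ℝ) ^ 2 := by
        nlinarith [Real.exp_one_gt_d9]
      nlinarith
  have hy0 : 0 < y := (Real.exp_pos 1).trans_le hy
  have hlog : 1 ≤ Real.log y := (Real.le_log_iff_exp_le hy0).2 hy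
  refine ⟨Nat.le_floor (by exact_mod_cast hlog),
    (Nat.floor_le (by linarith)).trans (Real.log_le_log hy0 hyT), ?_⟩
  have hyN : y ≤ Real.exp 1 * Real.exp ⌊Real.log y⌋₊ := by
    rw [← Real.exp_add, ← Real.log_le_iff_le_exp hy0]
    linarith [Nat.lt_floor_add_one (Real.log y)]
  have hyN2 : y ^ 2 ≤ (Real.exp 1 * Real.exp ⌊Real.log y⌋₊) ^ 2 := by gcongr
  have he2 : Real.exp 1 ^ 2 ≤ 2.72 ^ 2 := by gcongr; linarith
  rw [mul_pow, ← Real.exp_nat_mul ⌊Real.log y⌋₊] at hyN2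
  push_cast at hyN2
  nlinarith [Real.exp_pos (2 * (⌊Real.log y⌋₊ : ℝ))]

theorem three_le_of_le_five_mul_exp (hT : 275 ≤ T) (hTN : (T : ℝ) ≤ 5 * Real.exp (2 * N)) :
    3 ≤ N := by
  by_contra! hN
  have hT275 : (275 : ℝ) ≤ T := by exact_mod_cast hT
  have hN2 : (N : ℝ) ≤ 2 := by exact_mod_cast Nat.le_of_lt_succ hN
  have hexp : Real.exp (2 * N) ≤ 2.7183 ^ 4 :=
    calc Real.exp (2 * N) ≤ Real.exp ((4 : ℕ) * 1) := Real.exp_le_exp.2 (by push_cast; linarith)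
      _ = Real.exp 1 ^ 4 := Real.exp_nat_mul 1 4
      _ ≤ 2.7183 ^ 4 := by gcongr; linarith [Real.exp_one_lt_d9]
  norm_num at hexp
  linarith

end Complexity

/-! ### Fast rates -/

section FastRate

variable {Ω : Type*} {m0 : MeasurableSpace Ω} {P : Measure Ω}
  {ℱ : Filtration ℕ m0} {d : ℕ} {ℓ : ℕ → Ω → Param d → ℝ} {grad : ℕ → Ω → Param d → Fin d → ℝ}
  {G α β x : ℝ} {T N : ℕ} {Θ₀ : Finset (Param d)}

theorem IsConvexLossSequence.isLipschitzLoss (hℓ : IsConvexLossSequence P ℱ ℓ grad)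
    (hG : LipschitzLoss P grad G) (t : ℕ) : IsLipschitzLoss P (ℓ (t + 1)) (grad (t + 1)) G where
  integrable := hℓ.loss_integrable _ t.succ_pos
  subgradient := hℓ.grad_subgradient _ t.succ_pos
  norm_grad_le := hG _ t.succ_pos

theorem averageRisk_param_zero (ℓ : ℕ → Ω → Param 0 → ℝ) (pred : ℕ → Ω → Param 0) (T : ℕ)
    (θ : Param 0) (ω : Ω) : averageRisk P ℱ ℓ pred T θ ω = 0 := by
  rw [Subsingleton.elim pred fun _ _ => θ, averageRisk, sub_self]

variable [IsProbabilityMeasure P]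

theorem WeakExpConcave.surrogateBound_learningRate (h : WeakExpConcave P ℱ ℓ grad α β)
    (hL : ∀ t, IsLipschitzLoss P (ℓ (t + 1)) (grad (t + 1)) G)
    (hgrad : IsAdaptedOracle ℱ grad)
    (hα : 0 < α) (hβ : 0 ≤ β) (hβ1 : β ≤ 1) {a S η : ℝ} (ha : 0 < a) (hS : 0 < S) (hη : 0 ≤ η)
    (hcase : η ≤ a / (3 * S * (a / (α * S)) ^ (1 / (2 - β))) ∨
      η * G ^ 2 ≤ 9 * (a / (α * S)) ^ (1 / (2 - β))) (t : ℕ) :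
    SurrogateBound P (ℱ t) (ℓ (t + 1)) (grad (t + 1)) (3 * η)
      (108 * (a / (α * S)) ^ (1 / (2 - β))) := by
  have hg : Measurable fun q : Ω × Param d => grad (t + 1) q.1 q.2 :=
    measurable_of_prod_le (ℱ.le _) (hgrad t)
  have hρ : 0 ≤ (a / (α * S)) ^ (1 / (2 - β)) := by positivity
  rcases hcase with hsmall | hlarge
  · exact (h.surrogateBound hα.le hβ hβ1 hρ (three_mul_le_mul_rpow ha hα hβ1 hS hsmall) (hL t)
      hg).mono (by linarith)
  · exact ((hL t).surrogateBound hg (ℱ.le t) (by positivity)).mono (by linarith)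

theorem exists_event_averageRisk_squint_le
    (hL : ∀ t, IsLipschitzLoss P (ℓ (t + 1)) (grad (t + 1)) G)
    (hgrad : IsAdaptedOracle ℱ grad)
    (hα : 0 < α) (hβ : 0 ≤ β) (hβ1 : β ≤ 1) (hexp : WeakExpConcave P ℱ ℓ grad α β) (hx : 0 < x)
    (hd : d ≠ 0) (hT : 3 ≤ T) (hGT : Real.exp 1 ≤ G * T) (hN : 3 ≤ N)
    (hNlog : (N : ℝ) ≤ Real.log (4 * G / 3 * (T : ℝ) ^ 2))
    (hTN : (T : ℝ) ≤ 5 * Real.exp (2 * N)) (hΘb : (Θ₀ : Set (Param d)) ⊆ unitBall d)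
    (hcover : Metric.IsCover (((T : NNReal) ^ 2)⁻¹) (unitBall d) (Θ₀ : Set (Param d)))
    (hcard : (Θ₀.card : ℝ) ≤ (1 + 2 * (T : ℝ) ^ 2) ^ d) :
    ∃ A, MeasurableSet A ∧ 1 - Real.exp (-x) ≤ P.real A ∧ ∀ θ ∈ unitBall d,
      ∀ᵐ ω ∂P, ω ∈ A → averageRisk P ℱ ℓ
        (fun t ω' => squint Θ₀ (uniformPrior Θ₀) (4 * G / 3) N (fun s => grad s ω') t) T θ ω ≤
        207 * (complexityTerm d T G x / (α * T)) ^ (1 / (2 - β)) + G / (T : ℝ) ^ 2 +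
          297 * (G * complexityTerm d T G x / T) := by
  have hT0 : (0 : ℝ) < T := by exact_mod_cast (show 0 < T by omega)
  have hG := pos_of_exp_one_le_mul hGT
  have ha : 0 < complexityTerm d T G x := complexityTerm_pos hGT hx
  have ha1 : 1 ≤ complexityTerm d T G x := by
    have hd1 : (1 : ℝ) ≤ d := by exact_mod_cast Nat.one_le_iff_ne_zero.2 hd
    nlinarith [one_le_log_of_three_le hT, add_le_complexityTerm (d := d) (x := x) hGT]
  have hΘ : Θ₀.Nonempty := by
    simpa using hcover.nonempty (Metric.nonempty_closedBall.2 zero_le_one)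
  obtain ⟨i, hi, hiN, hregret, hcase⟩ := exists_learningRate_tradeoff ha1
    (ρ := (complexityTerm d T G x / (α * T)) ^ (1 / (2 - β))) (by positivity) hG (by omega) hN hTN
  have hη := learningRate_pos (show 0 < 4 * G / 3 by positivity) i
  obtain ⟨A, hA, hPA, hrisk⟩ := exists_event_averageRisk_le hL hgrad hΘb hcover (by positivity)
    (by linarith) hi hiN
    (hexp.surrogateBound_learningRate hL hgrad hα hβ hβ1 ha hT0 hη.le hcase)
    (show T ≠ 0 by omega) x
  refine ⟨A, hA, hPA, fun θ hθ => (hrisk θ hθ).mono fun ω hω hωA => (hω hωA).trans ?_⟩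
  have hlog := log_experts_le_complexityTerm hd hT hGT hx.le (by omega) hNlog hΘ.card_pos hcard
  have hregret' := div_le_div_of_nonneg_right hlog (mul_pos hη hT0).le
  rw [mul_div_assoc (11 : ℝ)] at hregret'
  push_cast
  rw [← div_eq_mul_inv]
  linarith

theorem ae_averageRisk_squint_le_two_mul
    (hL : ∀ t, IsLipschitzLoss P (ℓ (t + 1)) (grad (t + 1)) G)
    (hgrad : IsAdaptedOracle ℱ grad)
    (hΘ : Θ₀.Nonempty) (hΘb : (Θ₀ : Set (Param d)) ⊆ unitBall d) {E : ℝ} (hE : 0 < E) (hN : 1 ≤ N)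
    (hT : T ≠ 0) {θ : Param d} (hθ : θ ∈ unitBall d) :
    ∀ᵐ ω ∂P, averageRisk P ℱ ℓ
      (fun t ω' => squint Θ₀ (uniformPrior Θ₀) E N (fun s => grad s ω') t) T θ ω ≤ 2 * G := by
  have hball := squint_uniformPrior_mem hΘ hΘb hE hN
  simpa only [mul_comm G] using averageRisk_le_mul hL (measurable_squint hgrad)
    (fun t ω => hball _ t) hθ (fun t ω => norm_sub_le_two_of_mem_unitBall (hball _ t) hθ) hT

theorem le_of_le_of_le_two_mul {R a T : ℝ} (ha : 0 < a) (hα : 0 < α) (hβ1 : β ≤ 1) (hG : 0 < G)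
    (hT : 0 < T) (hαG : α * G ^ (2 - β) ≤ 1)
    (hR : R ≤ 207 * (a / (α * T)) ^ (1 / (2 - β)) + G / T ^ 2 + 297 * (G * a / T))
    (hR2 : R ≤ 2 * G) :
    R ≤ 504 * (a / (α * T)) ^ (1 / (2 - β)) + G / T ^ 2 := by
  have hmin := mul_min_le_rpow ha hα hβ1 hG hT hαG
  rcases le_total (a / T) 1 with haT | haT
  · rw [min_eq_left haT, ← mul_div_assoc] at hmin
    linarith
  · rw [min_eq_right haT] at hmin
    have : 0 < G / T ^ 2 := by positivity
    linarith

theorem proposition1_general (hL : ∀ t, IsLipschitzLoss P (ℓ (t + 1)) (grad (t + 1)) G)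
    (hgrad : IsAdaptedOracle ℱ grad)
    (hα : 0 < α) (hβ : 0 ≤ β) (hβ1 : β ≤ 1) (hexp : WeakExpConcave P ℱ ℓ grad α β) (hx : 0 < x)
    (hT : 1 ≤ T) (hGT : Real.exp 1 ≤ G * T) (hN : 1 ≤ N)
    (hNlog : (N : ℝ) ≤ Real.log (4 * G / 3 * (T : ℝ) ^ 2))
    (hTN : (T : ℝ) ≤ 5 * Real.exp (2 * N)) (hΘb : (Θ₀ : Set (Param d)) ⊆ unitBall d)
    (hcover : Metric.IsCover (((T : NNReal) ^ 2)⁻¹) (unitBall d) (Θ₀ : Set (Param d)))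
    (hcard : (Θ₀.card : ℝ) ≤ (1 + 2 * (T : ℝ) ^ 2) ^ d) :
    ∃ A, MeasurableSet A ∧ 1 - Real.exp (-x) ≤ P.real A ∧ ∀ θ ∈ unitBall d,
      (∀ᵐ ω ∂P, ω ∈ A → averageRisk P ℱ ℓ
          (fun t ω' => squint Θ₀ (uniformPrior Θ₀) (4 * G / 3) N (fun s => grad s ω') t) T θ ω ≤
        2 ^ 18 * ((complexityTerm d T G x / (α * T)) ^ (1 / (2 - β)) + G / (T : ℝ) ^ 2 +
          G * complexityTerm d T G x / T)) ∧
      (α * G ^ (2 - β) ≤ 1 → ∀ᵐ ω ∂P, ω ∈ A → averageRisk P ℱ ℓ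
          (fun t ω' => squint Θ₀ (uniformPrior Θ₀) (4 * G / 3) N (fun s => grad s ω') t) T θ ω ≤
        2 ^ 18 * ((complexityTerm d T G x / (α * T)) ^ (1 / (2 - β)) + G / (T : ℝ) ^ 2)) := by
  have hT0 : (0 : ℝ) < T := by exact_mod_cast hT
  have hG := pos_of_exp_one_le_mul hGT
  have ha : 0 < complexityTerm d T G x := complexityTerm_pos hGT hx
  have hρ : 0 ≤ (complexityTerm d T G x / (α * T)) ^ (1 / (2 - β)) := by positivity
  have hGT2 : 0 < G / (T : ℝ) ^ 2 := by positivity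
  have hGa : 0 < G * complexityTerm d T G x / T := by positivity
  have hΘ : Θ₀.Nonempty := by
    simpa using hcover.nonempty (Metric.nonempty_closedBall.2 zero_le_one)
  have htrivial : ∀ θ ∈ unitBall d, _ := fun θ hθ => ae_averageRisk_squint_le_two_mul hL hgrad hΘ
    hΘb (show 0 < 4 * G / 3 by positivity) hN (show T ≠ 0 by omega) hθ
  -- Only the rates `η_i` with `i ≥ 3` are small enough to be used; `T ≥ 275` forces `N ≥ 3`.
  rcases lt_or_ge T 275 with hTsmall | hTlarge
  · have hsmall : 2 * G ≤ 2 ^ 18 * (G / (T : ℝ) ^ 2) := by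
      have hT275 : (T : ℝ) ≤ 275 := by exact_mod_cast hTsmall.le
      rw [mul_div_assoc', le_div_iff₀ (by positivity)]
      nlinarith [pow_le_pow_left₀ hT0.le hT275 2]
    exact ⟨Set.univ, .univ, by simpa using (Real.exp_pos _).le, fun θ hθ =>
      ⟨(htrivial θ hθ).mono fun ω hω _ => by linarith,
        fun _ => (htrivial θ hθ).mono fun ω hω _ => by linarith⟩⟩
  rcases eq_or_ne d 0 with rfl | hd
  · refine ⟨Set.univ, .univ, by simpa using (Real.exp_pos _).le, fun _ _ =>
      ⟨.of_forall fun ω _ => ?_, fun _ => .of_forall fun ω _ => ?_⟩⟩ <;>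
      rw [averageRisk_param_zero] <;> positivity
  obtain ⟨A, hA, hPA, hrisk⟩ := exists_event_averageRisk_squint_le hL hgrad hα hβ hβ1 hexp hx hd
    (by omega) hGT (three_le_of_le_five_mul_exp hTlarge hTN) hNlog hTN hΘb hcover hcard
  refine ⟨A, hA, hPA, fun θ hθ => ⟨?_, fun hαG => ?_⟩⟩
  · filter_upwards [hrisk θ hθ] with ω hω hωA
    linarith [hω hωA]
  · filter_upwards [hrisk θ hθ, htrivial θ hθ] with ω hω htrivial hωA
    linarith [le_of_le_of_le_two_mul ha hα hβ1 hG hT0 hαG (hω hωA) htrivial]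

end FastRate

theorem proposition1 :
    ∃ C : ℝ, 0 < C ∧
      ∀ {Ω : Type*} {m0 : MeasurableSpace Ω} (P : Measure Ω) [IsProbabilityMeasure P]
        (ℱ : Filtration ℕ m0) (d : ℕ)
        (ℓ : ℕ → Ω → Param d → ℝ) (grad : ℕ → Ω → Param d → Fin d → ℝ)
        (G α β x : ℝ) (T N : ℕ) (Θ₀ : Finset (Param d)),
        IsConvexLossSequence P ℱ ℓ grad →
        LipschitzLoss P grad G →
        0 < α → 0 ≤ β → β ≤ 1 →
        WeakExpConcave P ℱ ℓ grad α β →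
        0 < x → 1 ≤ T → Real.exp 1 ≤ G * T →
        (N = ⌊Real.log (4 * G / 3 * T)⌋₊ ∧ 1 ≤ G ^ 2 * T ∨
          N = ⌊Real.log (4 * G / 3 * (T : ℝ) ^ 2)⌋₊) →
        IsMinimalCover (((T : NNReal) ^ 2)⁻¹) Θ₀ →
        ∃ A : Set Ω, MeasurableSet A ∧ 1 - 2 * Real.exp (-x) ≤ P.real A ∧
          ∀ θ ∈ unitBall d,
            (∀ᵐ ω ∂P, ω ∈ A →
              averageRisk P ℱ ℓ
                  (fun t ω' => squint Θ₀ (uniformPrior Θ₀) (4 * G / 3) N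
                    (fun s => grad s ω') t) T θ ω ≤
                C * ((complexityTerm d T G x / (α * T)) ^ (1 / (2 - β)) + G / (T : ℝ) ^ 2
                  + G * complexityTerm d T G x / T)) ∧
            (α * G ^ (2 - β) ≤ 1 → ∀ᵐ ω ∂P, ω ∈ A →
              averageRisk P ℱ ℓ
                  (fun t ω' => squint Θ₀ (uniformPrior Θ₀) (4 * G / 3) N
                    (fun s => grad s ω') t) T θ ω ≤
                C * ((complexityTerm d T G x / (α * T)) ^ (1 / (2 - β)) + G / (T : ℝ) ^ 2)) := by
  refine ⟨2 ^ 18, by positivity, ?_⟩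
  intro Ω m0 P _ ℱ d ℓ grad G α β x T N Θ₀ hℓ hG hα hβ hβ1 hexp hx hT hGT hN hΘ
  obtain ⟨hN1, hNlog, hTN⟩ := gridSize_bounds hT hGT hN
  have hcard : (Θ₀.card : ℝ) ≤ (1 + 2 * (T : ℝ) ^ 2) ^ d := by
    simpa using hΘ.card_le (by positivity)
  obtain ⟨A, hA, hPA, hrisk⟩ := proposition1_general (hℓ.isLipschitzLoss hG)
    (fun t => hℓ.grad_adapted _ t.succ_pos) hα hβ hβ1 hexp hx hT hGT hN1 hNlog hTN hΘ.1 hΘ.2.1 hcard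
  exact ⟨A, hA, by linarith [Real.exp_pos (-x)], hrisk⟩
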